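/- Let $0<m\le n$ be integers. $\mathbb{R}^n$ carries its usual Euclidean structure and $\mathrm{Gr}(\mathbb{R}^n,m)$ is the Grassmannian of $m$-dimensional linear subspaces of $\mathbb{R}^n$, with its Borel $\sigma$-algebra; $\pi_V$ is the orthogonal projection onto $V$. For $\delta>0$ and a bounded set $A\subset\mathbb{R}^n$, $\mathcal{N}_\delta(A)$ is the minimal number of closed balls of radius $\delta$ needed to cover $A$. For $V\in\mathrm{Gr}(\mathbb{R}^n,m)$ and $W\in\mathrm{Gr}(\mathbb{R}^n,n-m)$ put $d_\measuredangle(V,W)=|\det(v_1,\dots,v_m,w_1,\dots,w_{n-m})|$, where $(v_i)$ and $(w_j)$ are orthonormal bases of $V$ and $W$, and for $\rho\ge 0$ let $\mathcal{V}_\measuredangle(W,\rho)=\{V\in\mathrm{Gr}(\mathbb{R}^n,m) : d_\measuredangle(V,W)\le\rho\}$. Let $0<\alpha<n$ and $\kappa>0$. There exists $C>1$, depending only on $n,m,\alpha,\kappa$, such that for every $0<\epsilon<\kappa/C$ there is $\delta_0>0$, depending only on $n,m,\alpha,\kappa,\epsilon$ (and $C$), such that the following holds for all $0<\delta<\delta_0$.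 Let $A$ be a subset of the closed unit ball of $\mathbb{R}^n$ and $\mu$ a probability measure on $\mathrm{Gr}(\mathbb{R}^n,m)$. Assume that $$\mathcal{N}_\delta(A)\ge\delta^{-\alpha-C\epsilon}$$ and, if $m<n$, that $$\mu\bigl(\mathcal{V}_\measuredangle(W,\rho)\bigr)\le\delta^{-\epsilon}\rho^{\kappa}\qquad\text{for all }\rho\ge\delta\text{ and all }W\in\mathrm{Gr}(\mathbb{R}^n,n-m).$$ Then $\mu(\mathcal{E}(A))\le\delta^{\epsilon}$, where $$\mathcal{E}(A)=\bigl\{V\in\mathrm{Gr}(\mathbb{R}^n,m) : \exists A'\subset A,\ \mathcal{N}_\delta(A')\ge\delta^{\epsilon}\mathcal{N}_\delta(A)\ \text{and}\ \mathcal{N}_\delta(\pi_V(A'))<\delta^{-\frac{m}{n}\alpha-\epsilon}\bigr\}$$ (if $\mathcal{E}(A)$ is not measurable, $\mu(\mathcal{E}(A))$ denotes its outer measure). -/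

import Mathlib

open MeasureTheory

noncomputable section

/-- The Grassmannian of `m`-dimensional linear subspaces of `ℝⁿ`, where `ℝⁿ` carries its usual
Euclidean structure. -/
def Gr (n m : ℕ) : Type :=
  {V : Submodule ℝ (EuclideanSpace ℝ (Fin n)) // Module.finrank ℝ V = m}

/-- The orthogonal projection `π_V` onto `V`, as an operator of `ℝⁿ`. -/
def Gr.proj {n m : ℕ} (V : Gr n m) : EuclideanSpace ℝ (Fin n) →L[ℝ] EuclideanSpace ℝ (Fin n) :=
  V.1.starProjection

/-- The usual topology of the Grassmannian: the one given by the distance `‖π_V - π_W‖`. -/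
instance (n m : ℕ) : TopologicalSpace (Gr n m) :=
  TopologicalSpace.induced Gr.proj inferInstance

/-- The Grassmannian carries its Borel `σ`-algebra. -/
instance (n m : ℕ) : MeasurableSpace (Gr n m) := borel (Gr n m)

instance (n m : ℕ) : BorelSpace (Gr n m) := ⟨rfl⟩

/-- The minimal number of closed balls of radius `δ` (with centres anywhere in `ℝⁿ`) that are
needed to cover `A`. It is used for bounded `A` and `δ > 0` only, and is then finite. -/
def Ncov {n : ℕ} (δ : ℝ) (A : Set (EuclideanSpace ℝ (Fin n))) : ℕ :=
  (Metric.externalCoveringNumber δ.toNNReal A).toNat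

/-- For `δ > 0` and `A` bounded, no information is lost in `Ncov`. -/
theorem Ncov_cast {n : ℕ} {δ : ℝ} (hδ : 0 < δ) {A : Set (EuclideanSpace ℝ (Fin n))}
    (hA : Bornology.IsBounded A) :
    (Ncov δ A : ℕ∞) = Metric.externalCoveringNumber δ.toNNReal A := by
  obtain ⟨N, -, hN, hc⟩ := Metric.exists_finite_isCover_of_totallyBounded
    (Real.toNNReal_pos.2 hδ).ne'
    (hA.isCompact_closure.totallyBounded.subset subset_closure)
  refine ENat.natCast_toNat (ne_top_of_le_ne_top (Set.encard_ne_top_iff.2 hN) ?_)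
  exact iInf₂_le N hc

/-- The `n × n` matrix with columns `v₁, …, v_m, w₁, …, w_{n-m}` (for `m ≤ n`). -/
def frameMatrix {n m : ℕ} (v : Fin m → EuclideanSpace ℝ (Fin n))
    (w : Fin (n - m) → EuclideanSpace ℝ (Fin n)) : Matrix (Fin n) (Fin n) ℝ :=
  Matrix.of fun i j => if h : (j : ℕ) < m then v ⟨j, h⟩ i else w ⟨j - m, by omega⟩ i

/-- An orthonormal basis of `V`. -/
def Gr.onb {n m : ℕ} (V : Gr n m) : OrthonormalBasis (Fin m) ℝ V.1 :=
  (stdOrthonormalBasis ℝ V.1).reindex (finCongr V.2)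

/-- `|det (v₁, …, v_m, w₁, …, w_{n-m})|`, where the `vᵢ` form an orthonormal basis of `V` and
the `wⱼ` one of `W`. The choice of the bases does not matter, see `dang_eq`. -/
def dang {n m : ℕ} (V : Gr n m) (W : Gr n (n - m)) : ℝ :=
  |(frameMatrix (fun i => (V.onb i : EuclideanSpace ℝ (Fin n)))
    (fun j => (W.onb j : EuclideanSpace ℝ (Fin n)))).det|

theorem dang_eq {n m : ℕ} (hm : m ≤ n) (V : Gr n m) (W : Gr n (n - m))
    (v : OrthonormalBasis (Fin m) ℝ V.1) (w : OrthonormalBasis (Fin (n - m)) ℝ W.1) :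
    dang V W = |(frameMatrix (fun i => (v i : EuclideanSpace ℝ (Fin n)))
      (fun j => (w j : EuclideanSpace ℝ (Fin n)))).det| := by
  have key : ∀ (k : ℕ) (U : Submodule ℝ (EuclideanSpace ℝ (Fin n)))
      (a b : OrthonormalBasis (Fin k) ℝ U), ∃ P : Matrix (Fin k) (Fin k) ℝ, |P.det| = 1 ∧
        ∀ i j, (a j : EuclideanSpace ℝ (Fin n)) i
          = ∑ l, (b l : EuclideanSpace ℝ (Fin n)) i * P l j := by
    intro k U a b
    refine ⟨b.toBasis.toMatrix a, ?_, fun i j => ?_⟩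
    · simpa [Module.Basis.det_apply] using b.det_to_matrix_orthonormalBasis a
    · have h := b.toBasis.sum_toMatrix_smul_self a j
      have h2 := congrArg (fun x : U => (x : EuclideanSpace ℝ (Fin n)) i) h
      simp at h2
      rw [← h2]
      exact Finset.sum_congr rfl fun l _ => mul_comm _ _
  obtain ⟨P, hP, hP'⟩ := key m V.1 V.onb v
  obtain ⟨Q, hQ, hQ'⟩ := key (n - m) W.1 W.onb w
  let e : Fin n ≃ Fin m ⊕ Fin (n - m) :=
    (finCongr (by omega)).trans (finSumFinEquiv (m := m) (n := n - m)).symm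
  have split : ∀ f : Fin n → ℝ, ∑ x, f x = ∑ y, f (e.symm y) :=
    fun f => (Equiv.sum_comp e.symm f).symm
  have el : ∀ l : Fin m, ((e.symm (Sum.inl l) : Fin n) : ℕ) = l := fun l => by simp [e]
  have er : ∀ l : Fin (n - m), ((e.symm (Sum.inr l) : Fin n) : ℕ) = m + l := fun l => by simp [e]
  have fl : ∀ (a : Fin m → EuclideanSpace ℝ (Fin n)) (b : Fin (n - m) → EuclideanSpace ℝ (Fin n))
      (i : Fin n) (l : Fin m), frameMatrix a b i (e.symm (Sum.inl l)) = a l i := by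
    intro a b i l
    simp [frameMatrix, el]
  have fr : ∀ (a : Fin m → EuclideanSpace ℝ (Fin n)) (b : Fin (n - m) → EuclideanSpace ℝ (Fin n))
      (i : Fin n) (l : Fin (n - m)), frameMatrix a b i (e.symm (Sum.inr l)) = b l i := by
    intro a b i l
    simp [frameMatrix, er]
  have hmul : frameMatrix (fun i => (V.onb i : EuclideanSpace ℝ (Fin n)))
        (fun j => (W.onb j : EuclideanSpace ℝ (Fin n)))
      = frameMatrix (fun i => (v i : EuclideanSpace ℝ (Fin n)))
        (fun j => (w j : EuclideanSpace ℝ (Fin n)))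
        * (Matrix.fromBlocks P 0 0 Q).submatrix e e := by
    ext i j
    obtain ⟨j, rfl⟩ := e.symm.surjective j
    rw [Matrix.mul_apply, split, Fintype.sum_sum_type]
    rcases j with j | j
    · simp only [fl, fr, hP' i j, Matrix.submatrix_apply, Equiv.apply_symm_apply,
        Matrix.fromBlocks_apply₁₁, Matrix.fromBlocks_apply₂₁, Matrix.zero_apply, mul_zero,
        Finset.sum_const_zero, add_zero]
    · simp only [fl, fr, hQ' i j, Matrix.submatrix_apply, Equiv.apply_symm_apply,
        Matrix.fromBlocks_apply₁₂, Matrix.fromBlocks_apply₂₂, Matrix.zero_apply, mul_zero,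
        Finset.sum_const_zero, zero_add]
  rw [dang, hmul, Matrix.det_mul, Matrix.det_submatrix_equiv_self, Matrix.det_fromBlocks_zero₂₁,
    abs_mul, abs_mul, hP, hQ, mul_one, mul_one]

/-- The set of all `V` with `dang V W ≤ ρ`. -/
def Vang {n m : ℕ} (W : Gr n (n - m)) (ρ : ℝ) : Set (Gr n m) := {V | dang V W ≤ ρ}

/-- The set of exceptional directions of `A` at scale `δ`: those `V` for which some `A' ⊆ A` has
`N_δ(A') ≥ δ ^ ε N_δ(A)` and `N_δ(π_V(A')) < δ ^ (- (m / n) α - ε)`. -/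
def exceptionalSet (n m : ℕ) (δ α ε : ℝ) (A : Set (EuclideanSpace ℝ (Fin n))) : Set (Gr n m) :=
  {V | ∃ A' ⊆ A, δ ^ ε * (Ncov δ A : ℝ) ≤ (Ncov δ A' : ℝ) ∧
    (Ncov δ (V.proj '' A') : ℝ) < δ ^ (-((m : ℝ) / n * α) - ε)}

end

/-
Let `H_U` be the entropy, at a scale comparable to `δ`, of the projection to `U` of a uniformly
random point of a finite `δ`-separated set `B`. When `U` is transverse to `V`, entropy is almost
submodular: `H_{U + V} + H_{U ∩ V} ≤ H_U + H_V + O(log (1 / ρ))`, where `ρ` measures the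
transversality. Run Euclid's algorithm on dimensions along `n` subspaces `V₁, …, Vₙ` of dimension
`m` in general position: keep `U + Vᵢ` while its dimension is below `n`, otherwise split off the
whole space `U + Vᵢ` and continue with `U ∩ Vᵢ`. As `n * m` is divisible by `n`, nothing is left
at the end, so `m * H_{ℝⁿ} ≤ ∑ᵢ H_{Vᵢ} + O(log (1 / ρ))`: the average `H_{Vᵢ}` is at least
`(m / n) * log #B`, up to the error.

If the exceptional set had measure more than `δ ^ ε`, then non-concentration, used with `ρ` a small
power `δ ^ O(ε)`, would allow one to choose greedily about `δ ^ (-ε)` exceptional subspaces, any `n`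
of which are in general position. Each of them comes with a subset of `A` of proportion at least
`δ ^ ε`, so by pigeonhole some `n` of these subsets share a proportion `δ ^ O(ε)` of `A`. All `n`
projections of the common part are too small, which contradicts the inequality.
-/

section BallEntropy

open scoped BigOperators Finset

variable {ι X : Type*} [PseudoMetricSpace X]

/-- The number of points of `B` whose image under `f` lies in the closed ball of radius `r`
about `f b`. -/
noncomputable def ballCount (B : Finset ι) (f : ι → X) (r : ℝ) (b : ι) : ℕ :=
  #{c ∈ B | dist (f b) (f c) ≤ r}

/-- The entropy at scale `r` of the image under `f` of a uniformly random point of `B`: the mean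
of `log (#B / ballCount B f r b)`. Counting in balls instead of the cells of a partition is what
makes it submodular under 1-Lipschitz factor maps, up to a change of scale. -/
noncomputable def ballEntropy (B : Finset ι) (f : ι → X) (r : ℝ) : ℝ :=
  Real.log #B - 𝔼 b ∈ B, Real.log (ballCount B f r b)

variable {B T : Finset ι} {f : ι → X} {r s : ℝ}

theorem ballCount_pos (hr : 0 ≤ r) {b : ι} (hb : b ∈ B) : 0 < ballCount B f r b :=
  Finset.card_pos.2 ⟨b, Finset.mem_filter.2 ⟨hb, by rwa [dist_self]⟩⟩

theorem ballCount_cast_pos (hr : 0 ≤ r) {b : ι} (hb : b ∈ B) : (0 : ℝ) < ballCount B f r b :=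
  Nat.cast_pos.2 (ballCount_pos hr hb)

theorem sum_inv_ballCount_le_one (hT : T ⊆ B) (h : ∀ b ∈ T, ∀ c ∈ T, dist (f b) (f c) ≤ r) :
    ∑ b ∈ T, (ballCount B f r b : ℝ)⁻¹ ≤ 1 := by
  rcases T.eq_empty_or_nonempty with rfl | hne
  · simp
  have hcard : (0 : ℝ) < #T := Nat.cast_pos.2 hne.card_pos
  have hle : ∀ b ∈ T, (ballCount B f r b : ℝ)⁻¹ ≤ (#T : ℝ)⁻¹ := fun b hb =>
    inv_anti₀ hcard <| Nat.cast_le.2 <| Finset.card_le_card fun c hc =>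
      Finset.mem_filter.2 ⟨hT hc, h b hb c hc⟩
  calc ∑ b ∈ T, (ballCount B f r b : ℝ)⁻¹ ≤ #T • (#T : ℝ)⁻¹ := Finset.sum_le_card_nsmul _ _ _ hle
    _ = 1 := by rw [nsmul_eq_mul, mul_inv_cancel₀ hcard.ne']

theorem sum_inv_ballCount_le_card_image {κ : Type*} [DecidableEq κ] (hT : T ⊆ B) (g : ι → κ)
    (hg : ∀ b ∈ T, ∀ c ∈ T, g b = g c → dist (f b) (f c) ≤ r) :
    ∑ b ∈ T, (ballCount B f r b : ℝ)⁻¹ ≤ #(T.image g) := by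
  have hfibre : ∀ i ∈ T.image g, ∑ b ∈ T with g b = i, (ballCount B f r b : ℝ)⁻¹ ≤ 1 := fun i _ =>
    sum_inv_ballCount_le_one ((T.filter_subset _).trans hT) fun b hb c hc => by
      rw [Finset.mem_filter] at hb hc
      exact hg b hb.1 c hc.1 (hb.2.trans hc.2.symm)
  rw [← Finset.sum_fiberwise_of_maps_to fun b hb => Finset.mem_image_of_mem g hb]
  simpa only [nsmul_eq_mul, mul_one] using Finset.sum_le_card_nsmul _ _ _ hfibre

theorem expect_log_le_log_of_sum_le (hB : B.Nonempty) {q : ι → ℝ} (hq : ∀ b ∈ B, 0 < q b) {K : ℝ}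
    (h : ∑ b ∈ B, q b ≤ #B * K) : 𝔼 b ∈ B, Real.log (q b) ≤ Real.log K := by
  have hcard : (0 : ℝ) < #B := Nat.cast_pos.2 hB.card_pos
  have hmean : ∑ b ∈ B, (#B : ℝ)⁻¹ • q b ≤ K := by
    rwa [← Finset.smul_sum, smul_eq_mul, inv_mul_le_iff₀ hcard]
  have hjensen := strictConcaveOn_log_Ioi.concaveOn.le_map_sum (t := B) (w := fun _ => (#B : ℝ)⁻¹)
    (fun _ _ => by positivity) (by simp [hcard.ne']) hq
  rw [Finset.expect_eq_sum_div_card, div_eq_inv_mul, Finset.mul_sum]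
  exact hjensen.trans <| Real.log_le_log
    (Finset.sum_pos (fun b hb => mul_pos (inv_pos.2 hcard) (hq b hb)) hB) hmean

theorem ballEntropy_le_log_card_image {κ : Type*} [DecidableEq κ] (hB : B.Nonempty) (hr : 0 ≤ r)
    (g : ι → κ) (hg : ∀ b ∈ B, ∀ c ∈ B, g b = g c → dist (f b) (f c) ≤ r) :
    ballEntropy B f r ≤ Real.log #(B.image g) := by
  have hcard : (#B : ℝ) ≠ 0 := Nat.cast_ne_zero.2 hB.card_ne_zero
  have himage : (#(B.image g) : ℝ) ≠ 0 := Nat.cast_ne_zero.2 (hB.image g).card_ne_zero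
  have hlog := expect_log_le_log_of_sum_le hB (K := #(B.image g) / #B)
    (fun b hb => inv_pos.2 (ballCount_cast_pos (f := f) hr hb)) <| by
      rw [mul_div_cancel₀ _ hcard]
      exact sum_inv_ballCount_le_card_image subset_rfl g hg
  simp only [Real.log_inv, Finset.expect_neg_distrib, Real.log_div himage hcard] at hlog
  rw [ballEntropy]
  linarith

theorem log_card_sub_log_le_ballEntropy (hB : B.Nonempty) (hr : 0 ≤ r) {N : ℝ}
    (hN : ∀ b ∈ B, (ballCount B f r b : ℝ) ≤ N) :
    Real.log #B - Real.log N ≤ ballEntropy B f r := by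
  refine sub_le_sub_left (Finset.expect_le hB fun b hb => ?_) _
  exact Real.log_le_log (ballCount_cast_pos hr hb) (hN b hb)

theorem ballEntropy_const (hB : B.Nonempty) (hr : 0 ≤ r) (x : X) :
    ballEntropy B (fun _ => x) r = 0 := by
  have hcount : ∀ b, ballCount B (fun _ => x) r b = #B := fun b => by simp [ballCount, hr]
  simp only [ballEntropy, hcount, Finset.expect_const hB, sub_self]

theorem ballEntropy_le_add_log {κ : Type*} [DecidableEq κ] (hB : B.Nonempty) (hr : 0 ≤ r)
    (hs : 0 ≤ s) (g : ι → κ) (hg : ∀ b ∈ B, ∀ c ∈ B, g b = g c → dist (f b) (f c) ≤ r) {N : ℝ}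
    (hN : ∀ c ∈ B, (#({b ∈ B | dist (f b) (f c) ≤ s}.image g) : ℝ) ≤ N) :
    ballEntropy B f r ≤ ballEntropy B f s + Real.log N := by
  have hcr : ∀ b ∈ B, (0 : ℝ) < ballCount B f r b := fun b hb => ballCount_cast_pos hr hb
  have hcs : ∀ b ∈ B, (0 : ℝ) < ballCount B f s b := fun b hb => ballCount_cast_pos hs hb
  have hsum : ∑ b ∈ B, (ballCount B f s b : ℝ) * (ballCount B f r b : ℝ)⁻¹ ≤ #B * N :=
    calc ∑ b ∈ B, (ballCount B f s b : ℝ) * (ballCount B f r b : ℝ)⁻¹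
        = ∑ b ∈ B, ∑ c ∈ B with dist (f b) (f c) ≤ s, (ballCount B f r b : ℝ)⁻¹ := by
          simp only [Finset.sum_const, nsmul_eq_mul, ballCount]
      _ = ∑ c ∈ B, ∑ b ∈ B with dist (f b) (f c) ≤ s, (ballCount B f r b : ℝ)⁻¹ :=
          Finset.sum_comm' fun b c => by simp only [Finset.mem_filter]; tauto
      _ ≤ ∑ _c ∈ B, N := Finset.sum_le_sum fun c hc =>
          (sum_inv_ballCount_le_card_image (Finset.filter_subset _ _) g fun b hb d hd =>
            hg b (Finset.filter_subset _ _ hb) d (Finset.filter_subset _ _ hd)).trans (hN c hc)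
      _ = #B * N := by rw [Finset.sum_const, nsmul_eq_mul]
  have hlog := expect_log_le_log_of_sum_le hB
    (fun b hb => mul_pos (hcs b hb) (inv_pos.2 (hcr b hb))) hsum
  have hsplit : 𝔼 b ∈ B, Real.log ((ballCount B f s b : ℝ) * (ballCount B f r b : ℝ)⁻¹) =
      𝔼 b ∈ B, Real.log (ballCount B f s b) - 𝔼 b ∈ B, Real.log (ballCount B f r b) := by
    rw [← Finset.expect_sub_distrib]
    refine Finset.expect_congr rfl fun b hb => ?_
    rw [← div_eq_mul_inv, Real.log_div (hcs b hb).ne' (hcr b hb).ne']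
  rw [hsplit] at hlog
  simp only [ballEntropy]
  linarith

section Submodularity

variable {XP XQ XS XI : Type*} [PseudoMetricSpace XP] [PseudoMetricSpace XQ]
  [PseudoMetricSpace XS] [PseudoMetricSpace XI] {P : ι → XP} {Q : ι → XQ} {S : ι → XS} {I : ι → XI}

theorem ballCount_le_ballCount_add {b c : ι} (h : dist (f b) (f c) ≤ r) :
    ballCount B f s c ≤ ballCount B f (r + s) b :=
  Finset.card_le_card <| Finset.monotone_filter_right _ fun _ _ hd =>
    (dist_triangle _ (f c) _).trans (add_le_add h hd)

theorem ballCount_mul_ballCount_mul_inv_le_sum (hr : 0 ≤ r)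
    (hIP : ∀ b c, dist (I b) (I c) ≤ dist (P b) (P c)) (b : ι) :
    (ballCount B P r b : ℝ) * ballCount B Q r b * (ballCount B I (3 * r) b : ℝ)⁻¹ ≤
      ∑ p ∈ B ×ˢ B with dist (P b) (P p.1) ≤ r ∧ dist (Q b) (Q p.2) ≤ r,
        (ballCount B I (2 * r) p.1 : ℝ)⁻¹ := by
  have hprod : (ballCount B P r b : ℝ) * ballCount B Q r b =
      #{p ∈ B ×ˢ B | dist (P b) (P p.1) ≤ r ∧ dist (Q b) (Q p.2) ≤ r} := by
    rw [Finset.filter_product (fun c => dist (P b) (P c) ≤ r) (fun d => dist (Q b) (Q d) ≤ r),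
      Finset.card_product, Nat.cast_mul, ballCount, ballCount]
  rw [hprod, ← nsmul_eq_mul]
  refine Finset.card_nsmul_le_sum _ _ _ fun p hp => ?_
  rw [Finset.mem_filter, Finset.mem_product] at hp
  refine inv_anti₀ (ballCount_cast_pos (by positivity) hp.1.1) (Nat.cast_le.2 ?_)
  rw [show 3 * r = r + 2 * r by ring]
  exact ballCount_le_ballCount_add ((hIP _ _).trans hp.2.1)

theorem sum_inv_ballCount_fst_eq_card (hr : 0 ≤ r) :
    ∑ p ∈ B ×ˢ B with dist (f p.1) (f p.2) ≤ r, (ballCount B f r p.1 : ℝ)⁻¹ = #B := by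
  rw [Finset.sum_filter, Finset.sum_product, Finset.card_eq_sum_ones, Nat.cast_sum]
  refine Finset.sum_congr rfl fun b hb => ?_
  dsimp only
  rw [← Finset.sum_filter, Finset.sum_const, nsmul_eq_mul, Nat.cast_one]
  exact mul_inv_cancel₀ (ballCount_cast_pos hr hb).ne'

theorem sum_ballCount_ratio_le_card (hr : 0 ≤ r)
    (hS : ∀ b c, dist (P b) (P c) ≤ 2 * r → dist (Q b) (Q c) ≤ 2 * r → dist (S b) (S c) ≤ s)
    (hIP : ∀ b c, dist (I b) (I c) ≤ dist (P b) (P c))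
    (hIQ : ∀ b c, dist (I b) (I c) ≤ dist (Q b) (Q c)) :
    ∑ b ∈ B, (ballCount B P r b : ℝ) * ballCount B Q r b * (ballCount B I (3 * r) b : ℝ)⁻¹ *
      (ballCount B S s b : ℝ)⁻¹ ≤ #B := by
  calc ∑ b ∈ B, (ballCount B P r b : ℝ) * ballCount B Q r b * (ballCount B I (3 * r) b : ℝ)⁻¹ *
        (ballCount B S s b : ℝ)⁻¹
      ≤ ∑ b ∈ B, ∑ p ∈ B ×ˢ B with dist (P b) (P p.1) ≤ r ∧ dist (Q b) (Q p.2) ≤ r,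
          (ballCount B I (2 * r) p.1 : ℝ)⁻¹ * (ballCount B S s b : ℝ)⁻¹ := by
        refine Finset.sum_le_sum fun b _ => ?_
        rw [← Finset.sum_mul]
        gcongr
        exact ballCount_mul_ballCount_mul_inv_le_sum hr hIP b
    _ = ∑ p ∈ B ×ˢ B with dist (I p.1) (I p.2) ≤ 2 * r,
          ∑ b ∈ B with dist (P b) (P p.1) ≤ r ∧ dist (Q b) (Q p.2) ≤ r,
            (ballCount B I (2 * r) p.1 : ℝ)⁻¹ * (ballCount B S s b : ℝ)⁻¹ := by
        refine Finset.sum_comm' fun b p => ?_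
        simp only [Finset.mem_filter]
        refine ⟨fun h => ⟨⟨h.1, h.2.2⟩, h.2.1, ?_⟩, fun h => ⟨h.1.1, h.2.1, h.1.2⟩⟩
        linarith [dist_triangle_left (I p.1) (I p.2) (I b), hIP b p.1, hIQ b p.2, h.2.2.1, h.2.2.2]
    _ ≤ ∑ p ∈ B ×ˢ B with dist (I p.1) (I p.2) ≤ 2 * r, (ballCount B I (2 * r) p.1 : ℝ)⁻¹ := by
        refine Finset.sum_le_sum fun p _ => ?_
        rw [← Finset.mul_sum]
        refine mul_le_of_le_one_right (by positivity) ?_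
        refine sum_inv_ballCount_le_one (Finset.filter_subset _ _) fun b hb c hc => ?_
        rw [Finset.mem_filter] at hb hc
        apply hS
        · linarith [dist_triangle_right (P b) (P c) (P p.1), hb.2.1, hc.2.1]
        · linarith [dist_triangle_right (Q b) (Q c) (Q p.2), hb.2.2, hc.2.2]
    _ = #B := sum_inv_ballCount_fst_eq_card (by positivity)

/- If `c` and `d` agree with `b` through `P` and `Q` respectively, then they agree with each other
through `I`; so the triples `(b, c, d)` are counted by pairs `(c, d)` over `I`, and for a given
pair the admissible `b` lie in a single `S`-ball. -/
theorem ballEntropy_add_ballEntropy_le (hB : B.Nonempty) (hr : 0 ≤ r) (hs : 0 ≤ s)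
    (hS : ∀ b c, dist (P b) (P c) ≤ 2 * r → dist (Q b) (Q c) ≤ 2 * r → dist (S b) (S c) ≤ s)
    (hIP : ∀ b c, dist (I b) (I c) ≤ dist (P b) (P c))
    (hIQ : ∀ b c, dist (I b) (I c) ≤ dist (Q b) (Q c)) :
    ballEntropy B S s + ballEntropy B I (3 * r) ≤ ballEntropy B P r + ballEntropy B Q r := by
  have hP : ∀ b ∈ B, (0 : ℝ) < ballCount B P r b := fun b hb => ballCount_cast_pos hr hb
  have hQ : ∀ b ∈ B, (0 : ℝ) < ballCount B Q r b := fun b hb => ballCount_cast_pos hr hb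
  have hI : ∀ b ∈ B, (0 : ℝ) < ballCount B I (3 * r) b := fun b hb =>
    ballCount_cast_pos (by positivity) hb
  have hS' : ∀ b ∈ B, (0 : ℝ) < ballCount B S s b := fun b hb => ballCount_cast_pos hs hb
  have hlog := expect_log_le_log_of_sum_le hB (K := 1)
    (fun b hb => mul_pos (mul_pos (mul_pos (hP b hb) (hQ b hb)) (inv_pos.2 (hI b hb)))
      (inv_pos.2 (hS' b hb)))
    (by simpa only [mul_one] using sum_ballCount_ratio_le_card hr hS hIP hIQ)
  have hsplit : ∀ b ∈ B, Real.log ((ballCount B P r b : ℝ) * ballCount B Q r b *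
      (ballCount B I (3 * r) b : ℝ)⁻¹ * (ballCount B S s b : ℝ)⁻¹) =
      Real.log (ballCount B P r b) + Real.log (ballCount B Q r b)
        - Real.log (ballCount B I (3 * r) b) - Real.log (ballCount B S s b) := fun b hb => by
    rw [← div_eq_mul_inv, ← div_eq_mul_inv, Real.log_div _ (hS' b hb).ne',
      Real.log_div _ (hI b hb).ne', Real.log_mul (hP b hb).ne' (hQ b hb).ne']
    · exact (mul_pos (hP b hb) (hQ b hb)).ne'
    · exact (div_pos (mul_pos (hP b hb) (hQ b hb)) (hI b hb)).ne'
  rw [Finset.expect_congr rfl hsplit, Finset.expect_sub_distrib, Finset.expect_sub_distrib,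
    Finset.expect_add_distrib, Real.log_one] at hlog
  simp only [ballEntropy]
  linarith

end Submodularity

end BallEntropy

section Grid

open scoped Finset

variable {n : ℕ} {s R : ℝ}

/-- The cell of the cubic grid of side `s` that contains `x`. -/
noncomputable def gridCell (s : ℝ) (x : EuclideanSpace ℝ (Fin n)) : Fin n → ℤ := fun i => ⌊x i / s⌋

theorem dist_le_of_gridCell_eq (hs : 0 < s) {x y : EuclideanSpace ℝ (Fin n)}
    (h : gridCell s x = gridCell s y) : dist x y ≤ n * s := by
  have hcoord : ∀ i, dist (x i) (y i) ≤ s := fun i => by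
    have hdiv : |x i / s - y i / s| < 1 := Int.abs_sub_lt_one_of_floor_eq_floor (congrFun h i)
    rw [← sub_div, abs_div, abs_of_pos hs, div_lt_one hs] at hdiv
    exact hdiv.le
  rw [EuclideanSpace.dist_eq]
  refine Real.sqrt_le_iff.2 ⟨by positivity, ?_⟩
  calc ∑ i, dist (x i) (y i) ^ 2 ≤ ∑ _i : Fin n, s ^ 2 :=
        Finset.sum_le_sum fun i _ => pow_le_pow_left₀ dist_nonneg (hcoord i) 2
    _ = n * s ^ 2 := by rw [Fin.sum_const, nsmul_eq_mul]
    _ ≤ (n * s) ^ 2 := by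
        rw [mul_pow]
        gcongr
        exact_mod_cast Nat.le_self_pow two_ne_zero n

theorem gridCell_mem_piFinset (hs : 0 < s) {x c : EuclideanSpace ℝ (Fin n)} (h : dist x c ≤ R) :
    gridCell s x ∈ Fintype.piFinset fun i => Finset.Icc ⌊(c i - R) / s⌋ ⌊(c i + R) / s⌋ := by
  refine Fintype.mem_piFinset.2 fun i => ?_
  have hcoord : |x i - c i| ≤ R :=
    (PiLp.norm_apply_le (x - c) i).trans ((dist_eq_norm x c).symm.trans_le h)
  obtain ⟨hlow, hupp⟩ := abs_le.1 hcoord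
  exact Finset.mem_Icc.2 ⟨Int.floor_le_floor (by gcongr; linarith),
    Int.floor_le_floor (by gcongr; linarith)⟩

theorem card_Icc_floor_le {a b : ℝ} (h : a ≤ b) : (#(Finset.Icc ⌊a⌋ ⌊b⌋) : ℝ) ≤ b - a + 2 := by
  have hcard : (#(Finset.Icc ⌊a⌋ ⌊b⌋) : ℝ) = ⌊b⌋ + 1 - ⌊a⌋ := by
    exact_mod_cast Int.card_Icc_of_le _ _ (by linarith [Int.floor_le_floor h])
  linarith [Int.floor_le b, Int.lt_floor_add_one a]

theorem card_image_gridCell_le {ι : Type*} (hs : 0 < s) (hR : 0 ≤ R) (c : EuclideanSpace ℝ (Fin n))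
    (T : Finset ι) (f : ι → EuclideanSpace ℝ (Fin n)) (hT : ∀ x ∈ T, dist (f x) c ≤ R) :
    (#(T.image fun x => gridCell s (f x)) : ℝ) ≤ (2 * R / s + 2) ^ n := by
  have hsub : (T.image fun x => gridCell s (f x)) ⊆
      Fintype.piFinset fun i => Finset.Icc ⌊(c i - R) / s⌋ ⌊(c i + R) / s⌋ :=
    Finset.image_subset_iff.2 fun x hx => gridCell_mem_piFinset hs (hT x hx)
  calc (#(T.image fun x => gridCell s (f x)) : ℝ)
      ≤ ∏ i : Fin n, (#(Finset.Icc ⌊(c i - R) / s⌋ ⌊(c i + R) / s⌋) : ℝ) := by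
        exact_mod_cast (Finset.card_le_card hsub).trans_eq (Fintype.card_piFinset _)
    _ ≤ ∏ _i : Fin n, (2 * R / s + 2) := by
        refine Finset.prod_le_prod (fun _ _ => Nat.cast_nonneg _) fun i _ => ?_
        refine (card_Icc_floor_le (by gcongr; linarith)).trans_eq ?_
        ring
    _ = (2 * R / s + 2) ^ n := by rw [Fin.prod_const]

theorem ballEntropy_le_scale {ι : Type*} {B : Finset ι} (hB : B.Nonempty)
    (f : ι → EuclideanSpace ℝ (Fin n)) (hn : 0 < n) {r t : ℝ} (hr : 0 < r) (ht : 0 ≤ t) :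
    ballEntropy B f r ≤ ballEntropy B f (t * r) + n * Real.log (2 * n * t + 2) := by
  have hn' : (0 : ℝ) < n := Nat.cast_pos.2 hn
  have hcell : (0 : ℝ) < r / n := by positivity
  rw [← Real.log_pow]
  refine ballEntropy_le_add_log hB hr.le (by positivity) (fun b => gridCell (r / n) (f b))
    (fun b _ c _ h => ?_) fun c _ => ?_
  · simpa only [mul_div_cancel₀ r hn'.ne'] using dist_le_of_gridCell_eq hcell h
  · have hradius : 2 * (t * r) / (r / n) = 2 * n * t := by field_simp
    rw [← hradius]
    exact card_image_gridCell_le hcell (by positivity) (f c) _ f fun b hb =>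
      (Finset.mem_filter.1 hb).2

end Grid

section Projections

open scoped InnerProductSpace

variable {E : Type*} [NormedAddCommGroup E] [InnerProductSpace ℝ E] [FiniteDimensional ℝ E]
  {U V : Submodule ℝ E}

theorem norm_starProjection_mono (h : U ≤ V) (x : E) :
    ‖U.starProjection x‖ ≤ ‖V.starProjection x‖ := by
  rw [← Submodule.starProjection_comp_starProjection_of_le h, ContinuousLinearMap.comp_apply]
  exact U.norm_starProjection_apply_le _

theorem inner_eq_inner_starProjection (x : E) {u : E} (hu : u ∈ U) :
    ⟪x, u⟫_ℝ = ⟪U.starProjection x, u⟫_ℝ := by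
  rw [U.inner_starProjection_left_eq_right, Submodule.starProjection_eq_self_iff.2 hu]

theorem norm_starProjection_sup_le {K t : ℝ} (hK : 0 ≤ K)
    (h : ∀ u ∈ U, ∀ v ∈ V, ‖v‖ ≤ K * ‖u + v‖) {x : E} (hU : ‖U.starProjection x‖ ≤ t)
    (hV : ‖V.starProjection x‖ ≤ t) : ‖(U ⊔ V).starProjection x‖ ≤ (2 * K + 1) * t := by
  set y := (U ⊔ V).starProjection x
  have hyx : y ∈ U ⊔ V := (U ⊔ V).starProjection_apply_mem x
  have ht : 0 ≤ t := (norm_nonneg _).trans hV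
  obtain ⟨u, hu, v, hv, huv⟩ := Submodule.mem_sup.1 hyx
  have hv_le : ‖v‖ ≤ K * ‖y‖ := huv ▸ h u hu v hv
  have hu_le : ‖u‖ ≤ (K + 1) * ‖y‖ := by
    rw [eq_sub_of_add_eq huv]
    linarith [norm_sub_le y v]
  have hsq : ‖y‖ * ‖y‖ ≤ (2 * K + 1) * t * ‖y‖ :=
    calc ‖y‖ * ‖y‖ = ⟪x, y⟫_ℝ := by
          rw [inner_eq_inner_starProjection x hyx, real_inner_self_eq_norm_mul_norm]
      _ = ⟪U.starProjection x, u⟫_ℝ + ⟪V.starProjection x, v⟫_ℝ := by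
          rw [← inner_eq_inner_starProjection x hu, ← inner_eq_inner_starProjection x hv,
            ← inner_add_right, huv]
      _ ≤ ‖U.starProjection x‖ * ‖u‖ + ‖V.starProjection x‖ * ‖v‖ :=
          add_le_add (real_inner_le_norm _ _) (real_inner_le_norm _ _)
      _ ≤ t * ((K + 1) * ‖y‖) + t * (K * ‖y‖) := by gcongr
      _ = (2 * K + 1) * t * ‖y‖ := by ring
  rcases (norm_nonneg y).eq_or_lt with hzero | hpos
  · rw [← hzero]; positivity
  · exact le_of_mul_le_mul_right hsq hpos

end Projections

section Subspaces

variable {K E : Type*} [DivisionRing K] [AddCommGroup E] [Module K E]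

theorem exists_submodule_le_finrank_eq (U : Submodule K E) [Module.Finite K U] {k : ℕ}
    (hk : k ≤ Module.finrank K U) : ∃ W ≤ U, Module.finrank K W = k := by
  obtain ⟨f, hf⟩ := Module.le_rank_iff_exists_linearMap.1
    ((Nat.cast_le.2 hk).trans_eq (Module.finrank_eq_rank K U))
  refine ⟨(U.subtype ∘ₗ f).range, LinearMap.range_comp_le_range _ _ |>.trans_eq U.range_subtype, ?_⟩
  have hinj : Function.Injective (U.subtype ∘ₗ f) := U.injective_subtype.comp hf
  rw [LinearMap.finrank_range_of_inj hinj, Module.finrank_fin_fun]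

theorem exists_submodule_ge_finrank_eq [Module.Finite K E] (U : Submodule K E) {k : ℕ}
    (hU : Module.finrank K U ≤ k) (hk : k ≤ Module.finrank K E) :
    ∃ W, U ≤ W ∧ Module.finrank K W = k := by
  obtain ⟨U', hU'⟩ := U.exists_isCompl
  have hdim := Submodule.finrank_add_eq_of_isCompl hU'
  obtain ⟨T, hT, hTdim⟩ := exists_submodule_le_finrank_eq U' (k := k - Module.finrank K U) (by lia)
  have hsup := Submodule.finrank_sup_add_finrank_inf_eq U T
  rw [(hU'.disjoint.mono_right hT).eq_bot, finrank_bot] at hsup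
  exact ⟨U ⊔ T, le_sup_left, by lia⟩

end Subspaces

section Angle

variable {n m : ℕ}

theorem Gr.le (V : Gr n m) : m ≤ n := by
  simpa only [V.2, finrank_euclideanSpace_fin] using V.1.finrank_le

theorem exists_le_or_ge_gr (hmn : m ≤ n) (U : Submodule ℝ (EuclideanSpace ℝ (Fin n))) :
    ∃ W : Gr n m, U ≤ W.1 ∨ W.1 ≤ U := by
  rcases le_total (Module.finrank ℝ U) m with hU | hU
  · obtain ⟨W, hW, hdim⟩ :=
      exists_submodule_ge_finrank_eq U hU (hmn.trans_eq finrank_euclideanSpace_fin.symm)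
    exact ⟨⟨W, hdim⟩, Or.inl hW⟩
  · obtain ⟨W, hW, hdim⟩ := exists_submodule_le_finrank_eq U hU
    exact ⟨⟨W, hdim⟩, Or.inr hW⟩

theorem abs_det_le_prod_norm {E : Type*} [NormedAddCommGroup E] [InnerProductSpace ℝ E]
    (b : OrthonormalBasis (Fin n) ℝ E) (v : Fin n → E) :
    |b.toBasis.det v| ≤ ∏ i, ‖v i‖ := by
  have : Fact (Module.finrank ℝ E = n) :=
    ⟨by rw [Module.finrank_eq_card_basis b.toBasis, Fintype.card_fin]⟩
  rw [← b.toBasis.orientation.volumeForm_robust' b]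
  exact b.toBasis.orientation.abs_volumeForm_apply_le v

theorem alternatingMap_update_add_of_mem_span {R M N ι : Type*} [Ring R] [AddCommGroup M]
    [Module R M] [AddCommGroup N] [Module R N] [DecidableEq ι]
    (D : M [⋀^ι]→ₗ[R] N) (c : ι → M) (i : ι) (x : M) {y : M}
    (hy : y ∈ Submodule.span R (c '' {i}ᶜ)) :
    D (Function.update c i (x + y)) = D (Function.update c i x) := by
  rw [D.map_update_add, add_eq_left]
  have hspan : Submodule.span R (c '' {i}ᶜ) ≤ (D.toMultilinearMap.toLinearMap c i).ker := by
    rw [Submodule.span_le]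
    rintro _ ⟨j, hj, rfl⟩
    exact D.map_update_self c (Ne.symm hj)
  exact hspan hy

theorem abs_det_mul_abs_le_norm_smul_add {E : Type*} [NormedAddCommGroup E] [InnerProductSpace ℝ E]
    (b : OrthonormalBasis (Fin n) ℝ E) {c : Fin n → E} (hc : ∀ i, ‖c i‖ = 1) (i : Fin n) (t : ℝ)
    {y : E} (hy : y ∈ Submodule.span ℝ (c '' {i}ᶜ)) :
    |b.toBasis.det c| * |t| ≤ ‖t • c i + y‖ :=
  calc |b.toBasis.det c| * |t| = |b.toBasis.det (Function.update c i (t • c i + y))| := by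
        rw [alternatingMap_update_add_of_mem_span _ c i _ hy, AlternatingMap.map_update_smul,
          Function.update_eq_self, smul_eq_mul, abs_mul, mul_comm]
    _ ≤ ∏ j, ‖Function.update c i (t • c i + y) j‖ := abs_det_le_prod_norm b _
    _ = ‖t • c i + y‖ := by
        rw [Fintype.prod_eq_single i fun j hj => by rw [Function.update_of_ne hj, hc],
          Function.update_self]

/-- The concatenation of two tuples of lengths `m` and `n - m`, that is, the list of columns of
`frameMatrix v w`. -/
def frame {E : Type*} (v : Fin m → E) (w : Fin (n - m) → E) : Fin n → E :=
  fun j => if h : (j : ℕ) < m then v ⟨j, h⟩ else w ⟨j - m, by omega⟩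

theorem det_frameMatrix (v : Fin m → EuclideanSpace ℝ (Fin n))
    (w : Fin (n - m) → EuclideanSpace ℝ (Fin n)) :
    (frameMatrix v w).det = (EuclideanSpace.basisFun (Fin n) ℝ).toBasis.det (frame v w) := by
  rw [Module.Basis.det_apply]
  congr 1
  ext i j
  simp only [frameMatrix, frame, Matrix.of_apply, Module.Basis.toMatrix_apply,
    OrthonormalBasis.coe_toBasis_repr_apply, EuclideanSpace.basisFun_repr]
  split_ifs <;> rfl

theorem exists_orthonormalBasis_apply_eq {E ι : Type*} [NormedAddCommGroup E]
    [InnerProductSpace ℝ E] [FiniteDimensional ℝ E] [Fintype ι]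
    (hcard : Module.finrank ℝ E = Fintype.card ι) (i : ι) {x : E} (hx : ‖x‖ = 1) :
    ∃ b : OrthonormalBasis ι ℝ E, b i = x := by
  have hortho : Orthonormal ℝ (({i} : Set ι).domRestrict fun _ => x) :=
    ⟨fun _ => hx, fun j k hjk => absurd (Subsingleton.elim j k) hjk⟩
  obtain ⟨b, hb⟩ := hortho.exists_orthonormalBasis_extension_of_card_eq hcard
  exact ⟨b, hb i rfl⟩

theorem mem_span_frame_compl {U : Submodule ℝ (EuclideanSpace ℝ (Fin n))}
    (v : Fin m → EuclideanSpace ℝ (Fin n)) (b : OrthonormalBasis (Fin (n - m)) ℝ U) {i : Fin n}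
    (hi : (i : ℕ) < m) {w : EuclideanSpace ℝ (Fin n)} (hw : w ∈ U) :
    w ∈ Submodule.span ℝ (frame v (fun j => (b j : EuclideanSpace ℝ (Fin n))) '' {i}ᶜ) := by
  have hsum := congrArg U.subtype (b.sum_repr ⟨w, hw⟩)
  rw [map_sum] at hsum
  change _ = w at hsum
  rw [← hsum]
  refine Submodule.sum_mem _ fun j _ => ?_
  rw [map_smul]
  refine Submodule.smul_mem _ _ (Submodule.subset_span ⟨⟨m + j, by lia⟩, ?_, ?_⟩)
  · rintro rfl
    exact absurd hi (by simp)
  · simp [frame]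

theorem dang_mul_norm_le (V : Gr n m) (W : Gr n (n - m)) {v w : EuclideanSpace ℝ (Fin n)}
    (hv : v ∈ V.1) (hw : w ∈ W.1) : dang V W * ‖v‖ ≤ ‖v + w‖ := by
  rcases eq_or_ne v 0 with rfl | hv0
  · simp
  have hv0' : (⟨v, hv⟩ : V.1) ≠ 0 := fun h => hv0 (congrArg Subtype.val h)
  have hm : 0 < m := by
    rw [← V.2, Module.finrank_pos_iff_exists_ne_zero]
    exact ⟨_, hv0'⟩
  obtain ⟨a, ha⟩ := exists_orthonormalBasis_apply_eq (V.2.trans (Fintype.card_fin m).symm) ⟨0, hm⟩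
    (norm_smul_inv_norm (𝕜 := ℝ) hv0')
  let i₀ : Fin n := ⟨0, hm.trans_le V.le⟩
  have hnorm : ∀ i, ‖frame (fun i => (a i : EuclideanSpace ℝ (Fin n)))
      (fun j => (W.onb j : EuclideanSpace ℝ (Fin n))) i‖ = 1 := fun i => by
    unfold frame
    split_ifs
    exacts [a.orthonormal.1 _, W.onb.orthonormal.1 _]
  have hv_eq : ‖v‖ • frame (fun i => (a i : EuclideanSpace ℝ (Fin n)))
      (fun j => (W.onb j : EuclideanSpace ℝ (Fin n))) i₀ = v := by
    simp [frame, i₀, hm, ha, smul_smul, hv0]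
  have h := abs_det_mul_abs_le_norm_smul_add (EuclideanSpace.basisFun (Fin n) ℝ) hnorm i₀ ‖v‖
    (mem_span_frame_compl _ W.onb (i := i₀) hm hw)
  rwa [abs_norm, ← det_frameMatrix, ← dang_eq V.le V W a W.onb, hv_eq] at h

end Angle

section Transversality

variable {n m : ℕ} {ρ : ℝ}

theorem isCompl_of_dang_pos {V : Gr n m} {W : Gr n (n - m)} (h : 0 < dang V W) :
    IsCompl W.1 V.1 := by
  have hdisj : Disjoint W.1 V.1 := Submodule.disjoint_def.2 fun v hW hV => by
    have hle := dang_mul_norm_le V W hV (W.1.neg_mem hW)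
    rw [add_neg_cancel, norm_zero] at hle
    exact norm_le_zero_iff.1 (nonpos_of_mul_nonpos_right hle h)
  refine ⟨hdisj, codisjoint_iff.2 (Submodule.eq_top_of_disjoint _ _ ?_ hdisj)⟩
  rw [finrank_euclideanSpace_fin, V.2, W.2, Nat.sub_add_cancel V.le]

/-- Quantitative transversality of `V` to a subspace of arbitrary dimension: `V` makes a large
angle with a subspace of complementary dimension that contains `U` or is contained in `U`. -/
def IsTransverse (ρ : ℝ) (U : Submodule ℝ (EuclideanSpace ℝ (Fin n))) (V : Gr n m) : Prop :=
  ∃ W : Gr n (n - m), (U ≤ W.1 ∨ W.1 ≤ U) ∧ ρ < dang V W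

variable {U : Submodule ℝ (EuclideanSpace ℝ (Fin n))} {V : Gr n m}

theorem IsTransverse.inf_eq_bot (h : IsTransverse ρ U V) (hρ : 0 ≤ ρ)
    (hdim : Module.finrank ℝ U + m ≤ n) : U ⊓ V.1 = ⊥ := by
  obtain ⟨W, hUW, hW⟩ := h
  have hle : U ≤ W.1 := hUW.elim id fun hWU =>
    (Submodule.eq_of_le_of_finrank_le hWU (by have := W.2; omega)).ge
  exact ((isCompl_of_dang_pos (hρ.trans_lt hW)).disjoint.mono_left hle).eq_bot

theorem IsTransverse.sup_eq_top (h : IsTransverse ρ U V) (hρ : 0 ≤ ρ)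
    (hdim : n ≤ Module.finrank ℝ U + m) : U ⊔ V.1 = ⊤ := by
  obtain ⟨W, hUW, hW⟩ := h
  have hle : W.1 ≤ U := hUW.elim
    (fun hUW => (Submodule.eq_of_le_of_finrank_le hUW (by have := W.2; omega)).ge) id
  exact ((isCompl_of_dang_pos (hρ.trans_lt hW)).codisjoint.mono_left hle).eq_top

theorem IsTransverse.norm_starProjection_sup_le (h : IsTransverse ρ U V) (hρ : 0 < ρ)
    {x : EuclideanSpace ℝ (Fin n)} {t : ℝ} (hU : ‖U.starProjection x‖ ≤ t)
    (hV : ‖V.1.starProjection x‖ ≤ t) : ‖(U ⊔ V.1).starProjection x‖ ≤ (2 * ρ⁻¹ + 1) * t := by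
  obtain ⟨W, hUW, hW⟩ := h
  have hangle : ∀ w ∈ W.1, ∀ v ∈ V.1, ‖v‖ ≤ ρ⁻¹ * ‖w + v‖ := fun w hw v hv => by
    rw [le_inv_mul_iff₀ hρ, add_comm w v]
    exact (mul_le_mul_of_nonneg_right hW.le (norm_nonneg v)).trans (dang_mul_norm_le V W hv hw)
  rcases hUW with hUW | hWU
  · exact _root_.norm_starProjection_sup_le (inv_nonneg.2 hρ.le)
      (fun u hu => hangle u (hUW hu)) hU hV
  · refine (norm_starProjection_mono ?_ x).trans <| _root_.norm_starProjection_sup_le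
      (inv_nonneg.2 hρ.le) hangle ((norm_starProjection_mono hWU x).trans hU) hV
    rw [(isCompl_of_dang_pos (hρ.trans hW)).sup_eq_top]
    exact le_top

end Transversality

section BrascampLieb

open scoped List

variable {n m : ℕ} {B : Finset (EuclideanSpace ℝ (Fin n))} {r ρ : ℝ}

/-- The entropy at scale `r` of the orthogonal projection to `U` of a uniformly random point
of `B`. -/
noncomputable def projEntropy (B : Finset (EuclideanSpace ℝ (Fin n))) (r : ℝ)
    (U : Submodule ℝ (EuclideanSpace ℝ (Fin n))) : ℝ :=
  ballEntropy B U.starProjection r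

theorem projEntropy_bot (hB : B.Nonempty) (hr : 0 ≤ r) : projEntropy B r ⊥ = 0 := by
  rw [projEntropy, Submodule.starProjection_bot]
  exact ballEntropy_const hB hr 0

theorem projEntropy_sup_add_inf_le (hB : B.Nonempty) (hn : 0 < n) (hr : 0 < r) (hρ : 0 < ρ)
    (hρ1 : ρ ≤ 1) {U : Submodule ℝ (EuclideanSpace ℝ (Fin n))} {V : Gr n m}
    (h : IsTransverse ρ U V) :
    projEntropy B r (U ⊔ V.1) + projEntropy B r (U ⊓ V.1) ≤
      projEntropy B r U + projEntropy B r V.1 + 2 * n * Real.log (14 * n / ρ) := by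
  have hn1 : (1 : ℝ) ≤ n := Nat.one_le_cast.2 hn
  have hsub := ballEntropy_add_ballEntropy_le hB hr.le
    (P := U.starProjection) (Q := V.1.starProjection) (S := (U ⊔ V.1).starProjection)
    (I := (U ⊓ V.1).starProjection) (s := (4 * ρ⁻¹ + 2) * r) (by positivity)
    (fun b c hP hQ => by
      rw [dist_eq_norm, ← map_sub] at hP hQ ⊢
      exact (h.norm_starProjection_sup_le hρ hP hQ).trans_eq (by ring))
    (fun b c => by
      simpa only [dist_eq_norm, ← map_sub] using norm_starProjection_mono inf_le_left (b - c))
    (fun b c => by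
      simpa only [dist_eq_norm, ← map_sub] using norm_starProjection_mono inf_le_right (b - c))
  have hscale : ∀ t, 0 ≤ t → t ≤ 4 * ρ⁻¹ + 2 → ∀ S : Submodule ℝ (EuclideanSpace ℝ (Fin n)),
      projEntropy B r S ≤ projEntropy B (t * r) S + n * Real.log (14 * n / ρ) := by
    intro t ht htρ S
    refine (ballEntropy_le_scale hB S.starProjection hn hr ht).trans ?_
    rw [projEntropy, div_eq_mul_inv]
    gcongr
    nlinarith [(one_le_inv₀ hρ).2 hρ1]
  have hsup := hscale (4 * ρ⁻¹ + 2) (by positivity) le_rfl (U ⊔ V.1)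
  have hinf := hscale 3 (by norm_num) (by linarith [(one_le_inv₀ hρ).2 hρ1]) (U ⊓ V.1)
  simp only [projEntropy] at hsup hinf ⊢
  linarith

/-- Euclid's algorithm on subspaces: the next subspace is added as long as the sum of the
dimensions stays below `n`, and intersected otherwise. -/
noncomputable def euclidSubspace : List (Gr n m) → Submodule ℝ (EuclideanSpace ℝ (Fin n))
  | [] => ⊥
  | V :: l => if Module.finrank ℝ (euclidSubspace l) + m < n then euclidSubspace l ⊔ V.1
      else euclidSubspace l ⊓ V.1

/-- General position of a list of subspaces: each member is transverse to every subspace that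
Euclid's algorithm produces from fewer than `n` of the later members. -/
def IsTransverseList (ρ : ℝ) (l : List (Gr n m)) : Prop :=
  ∀ V l', V :: l' <+ l → l'.length < n → IsTransverse ρ (euclidSubspace l') V

theorem IsTransverseList.sublist {l l' : List (Gr n m)} (h : IsTransverseList ρ l)
    (hl : l' <+ l) : IsTransverseList ρ l' :=
  fun V l'' hs => h V l'' (hs.trans hl)

theorem projEntropy_euclidSubspace_cons_le (hB : B.Nonempty) (hr : 0 < r) (hρ : 0 < ρ)
    (hρ1 : ρ ≤ 1) {V : Gr n m} {l : List (Gr n m)} (h : IsTransverse ρ (euclidSubspace l) V)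
    (hl : Module.finrank ℝ (euclidSubspace l) < n) :
    ∃ s : ℕ, Module.finrank ℝ (euclidSubspace (V :: l)) + n * s =
        Module.finrank ℝ (euclidSubspace l) + m ∧
      Module.finrank ℝ (euclidSubspace (V :: l)) < n ∧
      projEntropy B r (euclidSubspace (V :: l)) + s * projEntropy B r ⊤ ≤
        projEntropy B r (euclidSubspace l) + projEntropy B r V.1 +
          2 * n * Real.log (14 * n / ρ) := by
  have hn : 0 < n := by omega
  have hsub := projEntropy_sup_add_inf_le hB hn hr hρ hρ1 h
  have hdim := Submodule.finrank_sup_add_finrank_inf_eq (euclidSubspace l) V.1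
  have hV : Module.finrank ℝ V.1 = m := V.2
  have hmn := V.le
  by_cases hlt : Module.finrank ℝ (euclidSubspace l) + m < n
  · rw [h.inf_eq_bot hρ.le hlt.le, finrank_bot] at hdim
    rw [h.inf_eq_bot hρ.le hlt.le, projEntropy_bot hB hr.le] at hsub
    rw [euclidSubspace, if_pos hlt]
    exact ⟨0, by omega, by omega, by simpa using hsub⟩
  · rw [h.sup_eq_top hρ.le (not_lt.1 hlt), finrank_top, finrank_euclideanSpace_fin] at hdim
    rw [h.sup_eq_top hρ.le (not_lt.1 hlt)] at hsub
    rw [euclidSubspace, if_neg hlt]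
    exact ⟨1, by omega, by omega, by rw [Nat.cast_one]; linarith⟩

theorem projEntropy_euclidSubspace_le (hB : B.Nonempty) (hn : 0 < n) (hr : 0 < r) (hρ : 0 < ρ)
    (hρ1 : ρ ≤ 1) {l : List (Gr n m)} (hl : l.length ≤ n) (ht : IsTransverseList ρ l) :
    ∃ t : ℕ, Module.finrank ℝ (euclidSubspace l) + n * t = l.length * m ∧
      Module.finrank ℝ (euclidSubspace l) < n ∧
      projEntropy B r (euclidSubspace l) + t * projEntropy B r ⊤ ≤
        (l.map fun V => projEntropy B r V.1).sum +
          l.length * (2 * n * Real.log (14 * n / ρ)) := by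
  induction l with
  | nil =>
    have hdim : Module.finrank ℝ (euclidSubspace ([] : List (Gr n m))) = 0 := finrank_bot _ _
    exact ⟨0, by simp [hdim], hdim ▸ hn, by simp [euclidSubspace, projEntropy_bot hB hr.le]⟩
  | cons V l ih =>
    rw [List.length_cons] at hl
    obtain ⟨t, hdim, hlt, hle⟩ := ih (by omega) (ht.sublist (List.sublist_cons_self V l))
    obtain ⟨s, hdim', hlt', hle'⟩ := projEntropy_euclidSubspace_cons_le hB hr hρ hρ1
      (ht V l (List.Sublist.refl _) hl) hlt
    refine ⟨s + t, ?_, hlt', ?_⟩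
    · rw [List.length_cons]
      linarith
    · rw [List.map_cons, List.sum_cons, List.length_cons]
      push_cast
      linarith

theorem IsTransverseList.mul_projEntropy_top_le (hB : B.Nonempty) (hn : 0 < n) (hr : 0 < r)
    (hρ : 0 < ρ) (hρ1 : ρ ≤ 1) {l : List (Gr n m)} (hl : l.length = n)
    (ht : IsTransverseList ρ l) :
    m * projEntropy B r ⊤ ≤ (l.map fun V => projEntropy B r V.1).sum +
      2 * n ^ 2 * Real.log (14 * n / ρ) := by
  obtain ⟨t, hdim, hlt, hle⟩ := projEntropy_euclidSubspace_le hB hn hr hρ hρ1 hl.le ht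
  rw [hl] at hdim hle
  have hzero : Module.finrank ℝ (euclidSubspace l) = 0 := Nat.eq_zero_of_dvd_of_lt
    ((Nat.dvd_add_left (dvd_mul_right n t)).1 (hdim ▸ dvd_mul_right n m)) hlt
  have htm : t = m := Nat.eq_of_mul_eq_mul_left hn (by omega)
  rw [Submodule.finrank_eq_zero.1 hzero, projEntropy_bot hB hr.le, htm] at hle
  linarith

end BrascampLieb

section Selection

open scoped List Finset

theorem card_toFinset_sublistsLen_le {ι : Type*} [DecidableEq ι] (l : List ι) (k : ℕ) :
    #(l.sublistsLen k).toFinset ≤ l.length ^ k :=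
  (List.toFinset_card_le _).trans
    ((List.length_sublistsLen k l).trans_le (Nat.choose_le_pow _ _))

section General

variable {n m : ℕ} {ρ p : ℝ} {μ : Measure (Gr n m)} {X : Set (Gr n m)}

theorem exists_mem_forall_isTransverse [IsFiniteMeasure μ]
    (hp : ∀ W, μ.real (Vang W ρ) ≤ p) {ι : Type*} (S : Finset ι)
    (U : ι → Submodule ℝ (EuclideanSpace ℝ (Fin n))) (h : #S * p < μ.real X) :
    ∃ V ∈ X, ∀ i ∈ S, IsTransverse ρ (U i) V := by
  choose W hW using fun i => exists_le_or_ge_gr (Nat.sub_le n m) (U i)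
  have hbad : μ.real (⋃ i ∈ S, Vang (W i) ρ) < μ.real X :=
    calc μ.real (⋃ i ∈ S, Vang (W i) ρ) ≤ ∑ i ∈ S, μ.real (Vang (W i) ρ) :=
          measureReal_biUnion_finset_le S _
      _ ≤ #S • p := Finset.sum_le_card_nsmul _ _ _ fun i _ => hp (W i)
      _ < μ.real X := by rwa [nsmul_eq_mul]
  obtain ⟨V, hVX, hV⟩ := Set.not_subset.1 fun hsub =>
    hbad.not_ge (measureReal_mono hsub (measure_ne_top μ _))
  refine ⟨V, hVX, fun i hi => ⟨W i, hW i, lt_of_not_ge fun hle => hV ?_⟩⟩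
  exact Set.mem_biUnion hi hle

theorem IsTransverseList.cons {V : Gr n m} {l : List (Gr n m)} (hl : IsTransverseList ρ l)
    (hV : ∀ l', l' <+ l → l'.length < n → IsTransverse ρ (euclidSubspace l') V) :
    IsTransverseList ρ (V :: l) := fun V' l' hs hl' => by
  rcases List.cons_sublist_cons'.1 hs with h | ⟨rfl, h⟩
  · exact hl V' l' h hl'
  · exact hV l' h hl'

theorem exists_isTransverseList [IsFiniteMeasure μ]
    (hp : ∀ W, μ.real (Vang W ρ) ≤ p) {M : ℕ} (h : n * M ^ n * p < μ.real X) :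
    ∃ l : List (Gr n m), l.length = M ∧ (∀ V ∈ l, V ∈ X) ∧ IsTransverseList ρ l := by
  classical
  suffices ∀ j ≤ M, ∃ l : List (Gr n m), l.length = j ∧ (∀ V ∈ l, V ∈ X) ∧
      IsTransverseList ρ l from this M le_rfl
  intro j
  induction j with
  | zero => exact fun _ => ⟨[], rfl, by simp, fun V l' hs => by simp at hs⟩
  | succ j ih =>
    intro hj
    obtain ⟨l, rfl, hX, hl⟩ := ih (by omega)
    let S := (Finset.range n).biUnion fun k => (l.sublistsLen k).toFinset
    have hS : #S ≤ n * M ^ n := by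
      refine (Finset.card_biUnion_le_card_mul _ _ (M ^ n) fun k hk => ?_).trans_eq
        (by rw [Finset.card_range])
      calc #(l.sublistsLen k).toFinset ≤ l.length ^ k := card_toFinset_sublistsLen_le l k
        _ ≤ M ^ k := by gcongr; omega
        _ ≤ M ^ n := Nat.pow_le_pow_right (by omega) (Finset.mem_range.1 hk).le
    obtain ⟨W, -⟩ := exists_le_or_ge_gr (Nat.sub_le n m) ⊥
    have hSp : #S * p ≤ n * M ^ n * p :=
      mul_le_mul_of_nonneg_right (by exact_mod_cast hS) (measureReal_nonneg.trans (hp W))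
    obtain ⟨V, hVX, hV⟩ :=
      exists_mem_forall_isTransverse hp S euclidSubspace (hSp.trans_lt h)
    refine ⟨V :: l, rfl, List.forall_mem_cons.2 ⟨hVX, hX⟩, hl.cons fun l' hs hl' => hV l' ?_⟩
    exact Finset.mem_biUnion.2 ⟨l'.length, Finset.mem_range.2 hl',
      List.mem_toFinset.2 (List.mem_sublistsLen_self hs)⟩

end General

section Pigeonhole

theorem mul_card_le_mul_card_filter_le {κ : Type*} {D : Finset κ} {f : κ → ℕ} {k M : ℕ}
    (hf : ∀ d ∈ D, f d ≤ M)
    (h : 2 * k * #D ≤ ∑ d ∈ D, f d) : k * #D ≤ M * #{d ∈ D | k ≤ f d} := by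
  have hsum : ∑ d ∈ D, f d ≤ ∑ d ∈ D, (k + if k ≤ f d then M else 0) := by
    refine Finset.sum_le_sum fun d hd => ?_
    have := hf d hd
    split_ifs <;> omega
  rw [Finset.sum_add_distrib, ← Finset.sum_filter, Finset.sum_const, Finset.sum_const,
    smul_eq_mul, smul_eq_mul] at hsum
  linarith

variable {ι κ : Type*} [DecidableEq κ] {D : Finset κ} {F : ι → Finset κ} {l : List ι} {k : ℕ}

theorem sum_countP_mem (hF : ∀ i ∈ l, F i ⊆ D) :
    ∑ d ∈ D, l.countP (fun i => d ∈ F i) = (l.map fun i => #(F i)).sum := by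
  induction l with
  | nil => simp
  | cons i l ih =>
    obtain ⟨hi, hl⟩ := List.forall_mem_cons.1 hF
    simp only [List.countP_cons, Finset.sum_add_distrib, List.map_cons, List.sum_cons, ih hl,
      decide_eq_true_eq]
    rw [← Finset.card_filter, Finset.filter_mem_eq_inter, Finset.inter_eq_right.2 hi, add_comm]

theorem exists_sublist_card_le_mul_card_filter {G : Finset κ} (hG : G.Nonempty)
    (h : ∀ d ∈ G, k ≤ l.countP (fun i => d ∈ F i)) :
    ∃ l', l' <+ l ∧ l'.length = k ∧ #G ≤ l.length ^ k * #{d ∈ G | ∀ i ∈ l', d ∈ F i} := by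
  classical
  have hex : ∀ d ∈ G, ∃ l' ∈ (l.sublistsLen k).toFinset, ∀ i ∈ l', d ∈ F i := fun d hd => by
    refine ⟨(l.filter fun i => d ∈ F i).take k, List.mem_toFinset.2 (List.mem_sublistsLen.2
      ⟨(List.take_sublist _ _).trans List.filter_sublist, ?_⟩), fun i hi => ?_⟩
    · rw [List.length_take, ← List.countP_eq_length_filter, min_eq_left (h d hd)]
    · simpa using (List.mem_filter.1 (List.mem_of_mem_take hi)).2
  choose! g hg hgF using hex
  obtain ⟨d, hd⟩ := hG
  obtain ⟨l', hl', hmax⟩ := Finset.exists_max_image (l.sublistsLen k).toFinset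
    (fun l' => #{d ∈ G | ∀ i ∈ l', d ∈ F i}) ⟨g d, hg d hd⟩
  obtain ⟨hsub, hlen⟩ := List.mem_sublistsLen.1 (List.mem_toFinset.1 hl')
  refine ⟨l', hsub, hlen, ?_⟩
  rw [mul_comm]
  refine (Finset.card_le_mul_card_image_of_maps_to hg _ fun l'' hl'' => ?_).trans
    (Nat.mul_le_mul_left _ (card_toFinset_sublistsLen_le l k))
  refine (Finset.card_le_card fun d hd => ?_).trans (hmax l'' hl'')
  obtain ⟨hdG, rfl⟩ := Finset.mem_filter.1 hd
  exact Finset.mem_filter.2 ⟨hdG, hgF d hdG⟩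

theorem exists_sublist_card_le_mul_card_inter (hD : D.Nonempty) (hk : 0 < k) {θ : ℝ}
    (hF : ∀ i ∈ l, F i ⊆ D) (hθ : ∀ i ∈ l, θ * #D ≤ #(F i)) (hl : 2 * k ≤ l.length * θ) :
    ∃ l', l' <+ l ∧ l'.length = k ∧
      #D ≤ l.length ^ (k + 1) * #{d ∈ D | ∀ i ∈ l', d ∈ F i} := by
  have hsum : (2 * k * #D : ℝ) ≤ ((l.map fun i => #(F i)).sum : ℕ) := by
    calc (2 * k * #D : ℝ) ≤ l.length * (θ * #D) := by rw [← mul_assoc]; gcongr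
      _ ≤ (l.map fun i => (#(F i) : ℝ)).sum := by
          simpa using List.sum_le_sum (f := fun _ => θ * (#D : ℝ)) hθ
      _ = ((l.map fun i => #(F i)).sum : ℕ) := by rw [Nat.cast_list_sum, List.map_map]; rfl
  rw [← sum_countP_mem hF] at hsum
  set G := {d ∈ D | k ≤ l.countP fun i => d ∈ F i}
  have hDG : #D ≤ l.length * #G := (Nat.le_mul_of_pos_left _ hk).trans
    (mul_card_le_mul_card_filter_le (fun d _ => List.countP_le_length) (by exact_mod_cast hsum))
  have hG : G.Nonempty :=
    Finset.card_pos.1 (Nat.pos_of_mul_pos_left (hD.card_pos.trans_le hDG))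
  obtain ⟨l', hl', hlen, hle⟩ := exists_sublist_card_le_mul_card_filter (F := F) hG
    fun d hd => (Finset.mem_filter.1 hd).2
  refine ⟨l', hl', hlen, hDG.trans ?_⟩
  rw [pow_succ', mul_assoc]
  exact Nat.mul_le_mul_left _ (hle.trans (Nat.mul_le_mul_left _ (Finset.card_le_card
    (Finset.filter_subset_filter _ (Finset.filter_subset _ _)))))

end Pigeonhole

end Selection

section Covering

open scoped Finset

variable {n m : ℕ} {δ s : ℝ} {A : Set (EuclideanSpace ℝ (Fin n))}

theorem Ncov_le_card {D : Finset (EuclideanSpace ℝ (Fin n))}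
    (h : ∀ a ∈ A, ∃ d ∈ D, dist a d ≤ δ) : Ncov δ A ≤ #D := by
  have hcover : Metric.IsCover δ.toNNReal A (D : Set (EuclideanSpace ℝ (Fin n))) := fun a ha => by
    obtain ⟨d, hd, had⟩ := h a ha
    exact ⟨d, hd, (edist_dist a d).trans_le (ENNReal.ofReal_le_ofReal had)⟩
  have hle := hcover.externalCoveringNumber_le_encard
  rw [Set.encard_coe_eq_coe_finsetCard] at hle
  exact ENat.toNat_le_of_le_natCast hle

theorem exists_card_le_Ncov (hδ : 0 < δ) (hA : Bornology.IsBounded A) :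
    ∃ D : Finset (EuclideanSpace ℝ (Fin n)), #D ≤ Ncov δ A ∧ ∀ a ∈ A, ∃ d ∈ D, dist a d ≤ δ := by
  have hlt : Metric.externalCoveringNumber δ.toNNReal A < (Ncov δ A + 1 : ℕ) := by
    rw [← Ncov_cast hδ hA]
    exact_mod_cast Nat.lt_succ_self _
  simp only [Metric.externalCoveringNumber, iInf_lt_iff] at hlt
  obtain ⟨C, hC, hCcard⟩ := hlt
  have hfin : C.Finite := Set.finite_of_encard_le_coe hCcard.le
  refine ⟨hfin.toFinset, ?_, fun a ha => ?_⟩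
  · rw [hfin.encard_eq_coe_toFinset_card] at hCcard
    exact Nat.lt_succ_iff.1 (by exact_mod_cast hCcard)
  · obtain ⟨c, hc, hac⟩ := hC ha
    refine ⟨c, hfin.mem_toFinset.2 hc, (ENNReal.ofReal_le_ofReal_iff hδ.le).1 ?_⟩
    exact (edist_dist a c).symm.trans_le hac

theorem Ncov_pos (hδ : 0 < δ) (hA : Bornology.IsBounded A) (hne : A.Nonempty) : 0 < Ncov δ A := by
  have hpos := (Metric.externalCoveringNumber_pos_iff (ε := δ.toNNReal)).2 hne
  rw [← Ncov_cast hδ hA] at hpos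
  exact_mod_cast hpos

theorem exists_gridCell_representatives (hA : Bornology.IsBounded A) (hs : 0 < s) :
    ∃ D : Finset (EuclideanSpace ℝ (Fin n)), (∀ a ∈ A, ∃ d ∈ D, dist a d ≤ n * s) ∧
      (D : Set _) ⊆ A ∧ Set.InjOn (gridCell s) (D : Set (EuclideanSpace ℝ (Fin n))) := by
  obtain ⟨R, hR⟩ := hA.subset_closedBall 0
  obtain ⟨D, hDA, hD⟩ := Set.exists_subset_bijOn A (gridCell s)
  have hfin : (gridCell s '' A).Finite := (Finset.finite_toSet _).subset <|
    Set.image_subset_iff.2 fun a ha => Finset.mem_coe.2 (gridCell_mem_piFinset hs (hR ha))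
  have hDfin : D.Finite := hD.finite_iff_finite.2 hfin
  refine ⟨hDfin.toFinset, fun a ha => ?_, by simpa using hDA, by simpa using hD.injOn⟩
  obtain ⟨d, hd, hda⟩ := hD.surjOn (Set.mem_image_of_mem _ ha)
  exact ⟨d, by simpa using hd, dist_le_of_gridCell_eq hs hda.symm⟩

variable {B D : Finset (EuclideanSpace ℝ (Fin n))}

theorem card_le_of_injOn_gridCell {R : ℝ} (hs : 0 < s) (hR : 0 ≤ R)
    {c : EuclideanSpace ℝ (Fin n)}
    (hD : Set.InjOn (gridCell s) (D : Set (EuclideanSpace ℝ (Fin n))))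
    (h : ∀ x ∈ D, dist x c ≤ R) : (#D : ℝ) ≤ (2 * R / s + 2) ^ n := by
  rw [← Finset.card_image_of_injOn hD]
  exact card_image_gridCell_le hs hR c D id h

theorem card_le_mul_Ncov (hδ : 0 < δ) (hs : 0 < s) (hA : Bornology.IsBounded A)
    (hDA : (D : Set _) ⊆ A)
    (hD : Set.InjOn (gridCell s) (D : Set (EuclideanSpace ℝ (Fin n)))) :
    (#D : ℝ) ≤ (2 * δ / s + 2) ^ n * Ncov δ A := by
  classical
  obtain ⟨C, hC, hcov⟩ := exists_card_le_Ncov hδ hA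
  have hsub : D ⊆ C.biUnion fun c => {d ∈ D | dist d c ≤ δ} := fun d hd => by
    obtain ⟨c, hc, hdc⟩ := hcov d (hDA hd)
    exact Finset.mem_biUnion.2 ⟨c, hc, Finset.mem_filter.2 ⟨hd, hdc⟩⟩
  calc (#D : ℝ) ≤ ∑ c ∈ C, (#{d ∈ D | dist d c ≤ δ} : ℝ) := by
        exact_mod_cast (Finset.card_le_card hsub).trans Finset.card_biUnion_le
    _ ≤ #C • (2 * δ / s + 2) ^ n := Finset.sum_le_card_nsmul _ _ _ fun c _ =>
        card_le_of_injOn_gridCell hs hδ.le (hD.mono (Finset.filter_subset _ _))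
          fun x hx => (Finset.mem_filter.1 hx).2
    _ ≤ (2 * δ / s + 2) ^ n * Ncov δ A := by rw [nsmul_eq_mul, mul_comm]; gcongr

theorem log_card_sub_le_projEntropy_top {r : ℝ} (hB : B.Nonempty) (hs : 0 < s) (hr : 0 ≤ r)
    (hinj : Set.InjOn (gridCell s) (B : Set (EuclideanSpace ℝ (Fin n)))) :
    Real.log #B - n * Real.log (2 * r / s + 2) ≤ projEntropy B r ⊤ := by
  rw [← Real.log_pow]
  refine log_card_sub_log_le_ballEntropy hB hr fun b _ => ?_
  refine card_le_of_injOn_gridCell hs hr (hinj.mono (Finset.filter_subset _ _))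
    (c := b) fun x hx => ?_
  simpa [dist_comm, Submodule.starProjection_top] using (Finset.mem_filter.1 hx).2

theorem projEntropy_le_log_Ncov (hB : B.Nonempty) (hδ : 0 < δ) (hA : Bornology.IsBounded A)
    (hBA : ∀ b ∈ B, ∃ a ∈ A, dist a b ≤ δ) (V : Gr n m) :
    projEntropy B (4 * δ) V.1 ≤ Real.log (Ncov δ (V.proj '' A)) := by
  classical
  obtain ⟨C, hC, hcov⟩ := exists_card_le_Ncov hδ (V.proj.lipschitz.isBounded_image hA)
  have hex : ∀ b ∈ B, ∃ c ∈ C, dist (V.1.starProjection b) c ≤ 2 * δ := fun b hb => by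
    obtain ⟨a, ha, hab⟩ := hBA b hb
    obtain ⟨c, hc, hac⟩ := hcov _ (Set.mem_image_of_mem _ ha)
    have hba : dist (V.proj b) (V.proj a) ≤ δ := by
      rw [dist_comm, dist_eq_norm, ← map_sub]
      exact (V.1.norm_starProjection_apply_le _).trans ((dist_eq_norm a b).symm.trans_le hab)
    exact ⟨c, hc, (dist_triangle (V.proj b) (V.proj a) c).trans (by linarith)⟩
  choose! g hgC hg using hex
  refine (ballEntropy_le_log_card_image hB (by positivity) g fun x hx y hy hxy => ?_).trans ?_
  · have h1 := hg x hx
    have h2 := hg y hy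
    rw [← hxy] at h2
    linarith [dist_triangle_right (V.1.starProjection x) (V.1.starProjection y) (g x)]
  · refine Real.log_le_log (by exact_mod_cast (hB.image g).card_pos) ?_
    exact_mod_cast (Finset.card_le_card (Finset.image_subset_iff.2 hgC)).trans hC

end Covering

section DiscreteBrascampLieb

open scoped Finset List

variable {n m : ℕ} {δ ρ N θ : ℝ} {l : List (Gr n m)}

theorem IsTransverseList.mul_log_card_le (hn : 0 < n) (hδ : 0 < δ) (hρ : 0 < ρ) (hρ1 : ρ ≤ 1)
    (hl : l.length = n) (ht : IsTransverseList ρ l)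
    {B : Finset (EuclideanSpace ℝ (Fin n))} (hB : B.Nonempty)
    (hinj : Set.InjOn (gridCell (δ / n)) (B : Set (EuclideanSpace ℝ (Fin n))))
    (hS : ∀ V ∈ l, ∃ S, Bornology.IsBounded S ∧ (∀ b ∈ B, ∃ a ∈ S, dist a b ≤ δ) ∧
      (Ncov δ (V.proj '' S) : ℝ) ≤ N) :
    m * (Real.log #B - n * Real.log (8 * n + 2)) ≤
      n * Real.log N + 2 * n ^ 2 * Real.log (14 * n / ρ) := by
  have hn' : (0 : ℝ) < n := Nat.cast_pos.2 hn
  have htop := log_card_sub_le_projEntropy_top hB (div_pos hδ hn') (r := 4 * δ) (by positivity) hinj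
  rw [show 2 * (4 * δ) / (δ / n) + 2 = 8 * n + 2 by field_simp; ring] at htop
  have hproj : ∀ V ∈ l, projEntropy B (4 * δ) V.1 ≤ Real.log N := fun V hV => by
    obtain ⟨S, hSb, hBS, hSN⟩ := hS V hV
    obtain ⟨b, hb⟩ := hB
    obtain ⟨a, ha, -⟩ := hBS b hb
    have hpos := Ncov_pos hδ (V.proj.lipschitz.isBounded_image hSb) ⟨_, Set.mem_image_of_mem _ ha⟩
    exact (projEntropy_le_log_Ncov ⟨b, hb⟩ hδ hSb hBS V).trans
      (Real.log_le_log (Nat.cast_pos.2 hpos) hSN)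
  calc m * (Real.log #B - n * Real.log (8 * n + 2)) ≤ m * projEntropy B (4 * δ) ⊤ := by gcongr
    _ ≤ (l.map fun V => projEntropy B (4 * δ) V.1).sum + 2 * n ^ 2 * Real.log (14 * n / ρ) :=
        ht.mul_projEntropy_top_le hB hn (by positivity) hρ hρ1 hl
    _ ≤ n * Real.log N + 2 * n ^ 2 * Real.log (14 * n / ρ) := by
        gcongr
        simpa [hl] using List.sum_le_sum hproj

theorem exists_gridCell_representatives_of_Ncov (hn : 0 < n) (hδ : 0 < δ)
    {A : Set (EuclideanSpace ℝ (Fin n))} (hA : Bornology.IsBounded A) (hne : A.Nonempty) :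
    ∃ D : Finset (EuclideanSpace ℝ (Fin n)), D.Nonempty ∧ (∀ a ∈ A, ∃ d ∈ D, dist a d ≤ δ) ∧
      Set.InjOn (gridCell (δ / n)) (D : Set (EuclideanSpace ℝ (Fin n))) ∧
      (#D : ℝ) ≤ (2 * n + 2) ^ n * Ncov δ A := by
  have hn' : (0 : ℝ) < n := Nat.cast_pos.2 hn
  have hs : 0 < δ / n := div_pos hδ hn'
  obtain ⟨D, hcov, hDA, hinj⟩ := exists_gridCell_representatives hA hs
  rw [mul_div_cancel₀ _ hn'.ne'] at hcov
  obtain ⟨a, ha⟩ := hne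
  obtain ⟨d, hd, -⟩ := hcov a ha
  have hcard := card_le_mul_Ncov hδ hs hA hDA hinj
  rw [show 2 * δ / (δ / n) + 2 = 2 * n + 2 by field_simp] at hcard
  exact ⟨D, ⟨d, hd⟩, hcov, hinj, hcard⟩

theorem exists_sublist_Ncov_le_mul_card (hn : 0 < n) (hδ : 0 < δ)
    {A : Set (EuclideanSpace ℝ (Fin n))} (hA : Bornology.IsBounded A) (hne : A.Nonempty)
    {ι : Type*} {l : List ι} {S : ι → Set (EuclideanSpace ℝ (Fin n))} (hSA : ∀ i ∈ l, S i ⊆ A)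
    (hS : ∀ i ∈ l, θ * Ncov δ A ≤ Ncov δ (S i))
    (hl : 2 * n * (2 * n + 2) ^ n ≤ l.length * θ) :
    ∃ (l' : List ι) (B : Finset (EuclideanSpace ℝ (Fin n))), l' <+ l ∧ l'.length = n ∧ B.Nonempty ∧
      Set.InjOn (gridCell (δ / n)) (B : Set (EuclideanSpace ℝ (Fin n))) ∧
      (∀ i ∈ l', ∀ b ∈ B, ∃ a ∈ S i, dist a b ≤ δ) ∧ Ncov δ A ≤ l.length ^ (n + 1) * #B := by
  classical
  obtain ⟨D, hD, hcov, hinj, hDA⟩ := exists_gridCell_representatives_of_Ncov hn hδ hA hne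
  have hθ : 0 ≤ θ := by
    refine (pos_of_mul_pos_right (lt_of_lt_of_le ?_ hl) (Nat.cast_nonneg _)).le
    positivity
  let F : ι → Finset (EuclideanSpace ℝ (Fin n)) := fun i => {d ∈ D | ∃ a ∈ S i, dist a d ≤ δ}
  have hF : ∀ i ∈ l, θ / (2 * n + 2) ^ n * #D ≤ #(F i) := fun i hi => by
    have hSF : Ncov δ (S i) ≤ #(F i) := Ncov_le_card fun a ha => by
      obtain ⟨d, hd, had⟩ := hcov a (hSA i hi ha)
      exact ⟨d, Finset.mem_filter.2 ⟨hd, a, ha, had⟩, had⟩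
    calc θ / (2 * n + 2) ^ n * #D ≤ θ / (2 * n + 2) ^ n * ((2 * n + 2) ^ n * Ncov δ A) := by gcongr
      _ = θ * Ncov δ A := by rw [← mul_assoc, div_mul_cancel₀ _ (by positivity)]
      _ ≤ #(F i) := (hS i hi).trans (Nat.cast_le.2 hSF)
  obtain ⟨l', hl', hlen, hcard⟩ := exists_sublist_card_le_mul_card_inter hD hn
    (fun i _ => Finset.filter_subset _ _) hF (by
      rwa [← mul_div_assoc, le_div_iff₀ (by positivity)])
  exact ⟨l', {d ∈ D | ∀ i ∈ l', d ∈ F i}, hl', hlen,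
    Finset.card_pos.1 (Nat.pos_of_mul_pos_left (hD.card_pos.trans_le hcard)),
    hinj.mono (Finset.filter_subset _ _),
    fun i hi b hb => (Finset.mem_filter.1 ((Finset.mem_filter.1 hb).2 i hi)).2,
    (Ncov_le_card hcov).trans hcard⟩

theorem IsTransverseList.mul_log_Ncov_le (hn : 0 < n) (hδ : 0 < δ) (hρ : 0 < ρ) (hρ1 : ρ ≤ 1)
    (ht : IsTransverseList ρ l) (hl : 2 * n * (2 * n + 2) ^ n ≤ l.length * θ)
    {A : Set (EuclideanSpace ℝ (Fin n))} (hA : Bornology.IsBounded A) (hne : A.Nonempty)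
    (hS : ∀ V ∈ l, ∃ S ⊆ A, θ * Ncov δ A ≤ Ncov δ S ∧ (Ncov δ (V.proj '' S) : ℝ) ≤ N) :
    m * (Real.log (Ncov δ A) - (n + 1) * Real.log l.length - n * Real.log (8 * n + 2)) ≤
      n * Real.log N + 2 * n ^ 2 * Real.log (14 * n / ρ) := by
  choose! S hSA hSθ hSN using hS
  obtain ⟨l', B, hl', hlen, hB, hinj, hBS, hcard⟩ :=
    exists_sublist_Ncov_le_mul_card hn hδ hA hne hSA hSθ hl
  have hBL := (ht.sublist hl').mul_log_card_le hn hδ hρ hρ1 hlen hB hinj fun V hV =>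
    ⟨S V, hA.subset (hSA V (hl'.subset hV)), hBS V hV, hSN V (hl'.subset hV)⟩
  have hlpos : 0 < l.length := hn.trans_le (hlen.symm.trans_le hl'.length_le)
  have hlog : Real.log (Ncov δ A) ≤ Real.log (l.length ^ (n + 1) * #B : ℕ) :=
    Real.log_le_log (Nat.cast_pos.2 (Ncov_pos hδ hA hne)) (Nat.cast_le.2 hcard)
  rw [Nat.cast_mul, Real.log_mul (by positivity) (Nat.cast_ne_zero.2 hB.card_ne_zero),
    Nat.cast_pow, Real.log_pow, Nat.cast_succ] at hlog
  refine le_trans ?_ hBL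
  gcongr
  linarith

end DiscreteBrascampLieb

section Exceptional

variable {n m : ℕ} {A : Set (EuclideanSpace ℝ (Fin n))} {α κ ε δ a b t C : ℝ}

theorem exceptionalSet_self_eq_empty (hn : 0 < n) (hδ : 0 < δ) (hδ1 : δ ≤ 1) (hε : 0 ≤ ε)
    (hC : 2 ≤ C) (hA : δ ^ (-α - C * ε) ≤ Ncov δ A) : exceptionalSet n n δ α ε A = ∅ := by
  rw [Set.eq_empty_iff_forall_notMem]
  rintro V ⟨S, -, hSA, hS⟩
  have hV : V.1 = ⊤ := Submodule.eq_top_of_finrank_eq (by rw [V.2, finrank_euclideanSpace_fin])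
  have hproj : V.proj '' S = S := by
    simp only [Gr.proj, hV, Submodule.starProjection_top, ContinuousLinearMap.coe_id', Set.image_id]
  rw [hproj, div_self (Nat.cast_ne_zero.2 hn.ne'), one_mul] at hS
  refine hS.not_ge (le_trans ?_ hSA)
  calc δ ^ (-α - ε) ≤ δ ^ (ε + (-α - C * ε)) :=
        Real.rpow_le_rpow_of_exponent_ge hδ hδ1 (by nlinarith)
    _ = δ ^ ε * δ ^ (-α - C * ε) := Real.rpow_add hδ _ _
    _ ≤ δ ^ ε * Ncov δ A := by gcongr

theorem mul_pow_mul_le_one (hn : 0 < n) (hb : n ≤ b) (ht : 0 < t)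
    (h : 5 * n ^ 2 * Real.log b ≤ -Real.log t) : n * b ^ n * t ≤ 1 := by
  have hn1 : (1 : ℝ) ≤ n := Nat.one_le_cast.2 hn
  have hb0 : 0 < b := by linarith
  have hlogn : Real.log n ≤ Real.log b := Real.log_le_log (by positivity) hb
  have hlogb : 0 ≤ Real.log b := Real.log_nonneg (hn1.trans hb)
  rw [← Real.log_nonpos_iff (by positivity), Real.log_mul (by positivity) ht.ne',
    Real.log_mul (by positivity) (by positivity), Real.log_pow]
  nlinarith [mul_nonneg (show (0 : ℝ) ≤ 5 * n ^ 2 - n - 1 by nlinarith) hlogb]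

theorem exists_isTransverseList_of_lt_measureReal {μ : Measure (Gr n m)} [IsFiniteMeasure μ]
    {X : Set (Gr n m)} {ρ : ℝ} {M : ℕ} (ht : 0 < t) (hp : ∀ W, μ.real (Vang W ρ) ≤ t ^ (n + 2))
    (hX : t < μ.real X) (hM : M * t ≤ b) (hb : n * b ^ n * t ≤ 1) :
    ∃ l : List (Gr n m), l.length = M ∧ (∀ V ∈ l, V ∈ X) ∧ IsTransverseList ρ l := by
  refine exists_isTransverseList hp (lt_of_le_of_lt ?_ hX)
  calc n * M ^ n * t ^ (n + 2) = n * (M * t) ^ n * t * t := by ring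
    _ ≤ n * b ^ n * t * t := by gcongr
    _ ≤ t := mul_le_of_le_one_left ht.le hb

theorem nonempty_of_Ncov_pos (h : 0 < Ncov δ A) : A.Nonempty := by
  refine Set.nonempty_iff_ne_empty.2 fun hA => h.ne' ?_
  rw [hA, Ncov, Metric.externalCoveringNumber_empty, ENat.toNat_zero]

theorem IsTransverseList.mul_log_le (hn : 0 < n) (hδ : 0 < δ) (hδ1 : δ ≤ 1)
    (hε : 0 ≤ ε) (ha : 0 ≤ a) (hb : 14 * n * (2 * n + 2) ^ n ≤ b) (hA : Bornology.IsBounded A)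
    (hAN : δ ^ (-α - C * ε) ≤ Ncov δ A) {l : List (Gr n m)}
    (hl : ∀ V ∈ l, V ∈ exceptionalSet n m δ α ε A) (ht : IsTransverseList (δ ^ (a * ε)) l)
    (hlen : 2 * n * (2 * n + 2) ^ n ≤ l.length * δ ^ ε) (hlen' : l.length * δ ^ ε ≤ b) :
    m * ((-α - C * ε) * Real.log δ - (n + 1) * (Real.log b - ε * Real.log δ) - n * Real.log b) ≤
      (-(m * α) - n * ε) * Real.log δ + 2 * n ^ 2 * (Real.log b - a * ε * Real.log δ) := by
  have hn1 : (1 : ℝ) ≤ n := Nat.one_le_cast.2 hn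
  have hNA : 0 < Ncov δ A := Nat.cast_pos.1 ((Real.rpow_pos_of_pos hδ _).trans_le hAN)
  have hlen0 : 0 < l.length * δ ^ ε := lt_of_lt_of_le (by positivity) hlen
  have hmain := ht.mul_log_Ncov_le hn hδ (by positivity)
    (Real.rpow_le_one hδ.le hδ1 (by positivity)) hlen hA (nonempty_of_Ncov_pos hNA) fun V hV => by
      obtain ⟨S, hSA, hS, hSV⟩ := hl V hV
      exact ⟨S, hSA, hS, hSV.le⟩
  have hlogA := Real.log_le_log (Real.rpow_pos_of_pos hδ _) hAN
  have hlogM := Real.log_le_log hlen0 hlen'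
  have hpow : (2 * n + 2 : ℝ) ≤ (2 * n + 2) ^ n := le_self_pow₀ (by linarith) hn.ne'
  have hb14 : Real.log (14 * n) ≤ Real.log b := Real.log_le_log (by positivity) (by nlinarith)
  have hb8 : Real.log (8 * n + 2) ≤ Real.log b := Real.log_le_log (by positivity) (by nlinarith)
  rw [Real.log_rpow hδ] at hlogA
  rw [Real.log_mul (left_ne_zero_of_mul hlen0.ne') (by positivity), Real.log_rpow hδ] at hlogM
  rw [Real.log_rpow hδ, Real.log_div (by positivity) (by positivity), Real.log_rpow hδ] at hmain
  calc _ ≤ m * (Real.log (Ncov δ A) - (n + 1) * Real.log l.length - n * Real.log (8 * n + 2)) := by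
        gcongr
        linarith
    _ ≤ _ := hmain
    _ = (-(m * α) - n * ε) * Real.log δ + 2 * n ^ 2 * (Real.log (14 * n) - a * ε * Real.log δ) := by
        field_simp
    _ ≤ _ := by gcongr

theorem IsTransverseList.neg_log_le (hm : 0 < m) (hmn : m ≤ n) (hδ : 0 < δ) (hδ1 : δ ≤ 1)
    (hε : 0 ≤ ε) (ha : 0 ≤ a) (hC : 2 * n + 2 + 2 * n ^ 2 * a ≤ C)
    (hb : 14 * n * (2 * n + 2) ^ n ≤ b) (hA : Bornology.IsBounded A)
    (hAN : δ ^ (-α - C * ε) ≤ Ncov δ A) {l : List (Gr n m)}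
    (hl : ∀ V ∈ l, V ∈ exceptionalSet n m δ α ε A) (ht : IsTransverseList (δ ^ (a * ε)) l)
    (hlen : 2 * n * (2 * n + 2) ^ n ≤ l.length * δ ^ ε) (hlen' : l.length * δ ^ ε ≤ b) :
    -(ε * Real.log δ) ≤ 5 * n ^ 2 * Real.log b := by
  have hn : 0 < n := hm.trans_le hmn
  have hn1 : (1 : ℝ) ≤ n := Nat.one_le_cast.2 hn
  have hm1 : (1 : ℝ) ≤ m := Nat.one_le_cast.2 hm
  have hmn' : (m : ℝ) ≤ n := Nat.cast_le.2 hmn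
  have hx : 0 ≤ -(ε * Real.log δ) :=
    neg_nonneg.2 (mul_nonpos_of_nonneg_of_nonpos hε (Real.log_nonpos hδ.le hδ1))
  have hpow : (1 : ℝ) ≤ (2 * n + 2) ^ n := one_le_pow₀ (by linarith)
  have hlogb : 0 ≤ Real.log b := Real.log_nonneg (by nlinarith)
  have hcoeff : 1 ≤ m * (C - (n + 1)) - n - 2 * n ^ 2 * a := by
    have hC' : n + 1 + 2 * n ^ 2 * a ≤ C - (n + 1) := by linarith
    have hC0 : 0 ≤ C - (n + 1) := le_trans (by positivity) hC'
    linarith [le_mul_of_one_le_left hC0 hm1]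
  calc -(ε * Real.log δ)
      ≤ (m * (C - (n + 1)) - n - 2 * n ^ 2 * a) * -(ε * Real.log δ) :=
        le_mul_of_one_le_left hx hcoeff
    _ ≤ (m * (2 * n + 1) + 2 * n ^ 2) * Real.log b := by
        linarith [ht.mul_log_le hn hδ hδ1 hε ha hb hA hAN hl hlen hlen']
    _ ≤ 5 * n ^ 2 * Real.log b := by
        gcongr
        nlinarith

theorem measureReal_exceptionalSet_le (hm : 0 < m) (hmn : m ≤ n) (hδ : 0 < δ) (hδ1 : δ ≤ 1)
    (hε : 0 ≤ ε) (ha : 0 ≤ a) (haε : a * ε ≤ 1) (haκ : a * κ = n + 3)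
    (hC : 2 * n + 2 + 2 * n ^ 2 * a ≤ C) (hb : 14 * n * (2 * n + 2) ^ n ≤ b)
    (hδb : 5 * n ^ 2 * Real.log b < -(ε * Real.log δ)) (hA : Bornology.IsBounded A)
    {μ : Measure (Gr n m)} [IsFiniteMeasure μ] (hAN : δ ^ (-α - C * ε) ≤ Ncov δ A)
    (hμ : ∀ ρ, δ ≤ ρ → ∀ W, μ.real (Vang W ρ) ≤ δ ^ (-ε) * ρ ^ κ) :
    μ.real (exceptionalSet n m δ α ε A) ≤ δ ^ ε := by
  by_contra! hX
  have hn : 0 < n := hm.trans_le hmn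
  have hn1 : (1 : ℝ) ≤ n := Nat.one_le_cast.2 hn
  have hpow : (1 : ℝ) ≤ (2 * n + 2) ^ n := one_le_pow₀ (by linarith)
  have hδε : 0 < δ ^ ε := Real.rpow_pos_of_pos hδ ε
  have hρ : δ ≤ δ ^ (a * ε) := by
    simpa using Real.rpow_le_rpow_of_exponent_ge hδ hδ1 haε
  have hp : δ ^ (-ε) * (δ ^ (a * ε)) ^ κ = (δ ^ ε) ^ (n + 2) := by
    rw [← Real.rpow_mul hδ.le, ← Real.rpow_add hδ, ← Real.rpow_mul_natCast hδ.le]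
    congr 1
    push_cast
    linear_combination ε * haκ
  have hsmall : n * b ^ n * δ ^ ε ≤ 1 :=
    mul_pow_mul_le_one hn (by nlinarith) hδε (hδb.le.trans_eq (by rw [Real.log_rpow hδ]))
  let M := ⌈2 * n * (2 * n + 2) ^ n / δ ^ ε⌉₊
  have hM : 2 * n * (2 * n + 2) ^ n ≤ M * δ ^ ε := (div_le_iff₀ hδε).1 (Nat.le_ceil _)
  have hM' : M * δ ^ ε ≤ b := by
    have hlt := Nat.ceil_lt_add_one (a := 2 * n * (2 * n + 2) ^ n / δ ^ ε) (by positivity)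
    have hle : δ ^ ε ≤ 1 := Real.rpow_le_one hδ.le hδ1 hε
    calc M * δ ^ ε ≤ (2 * n * (2 * n + 2) ^ n / δ ^ ε + 1) * δ ^ ε := by gcongr
      _ = 2 * n * (2 * n + 2) ^ n + δ ^ ε := by field_simp
      _ ≤ b := by nlinarith
  obtain ⟨l, hlen, hl, ht⟩ :=
    exists_isTransverseList_of_lt_measureReal hδε (fun W => (hμ _ hρ W).trans_eq hp) hX hM' hsmall
  rw [← hlen] at hM hM'
  exact hδb.not_ge (ht.neg_log_le hm hmn hδ hδ1 hε ha hC hb hA hAN hl hM hM')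

end Exceptional

theorem proposition16_general {n m : ℕ} (hm : 0 < m) (hmn : m ≤ n) {κ : ℝ} (hκ : 0 < κ) :
    ∃ C : ℝ, 1 < C ∧ ∀ ε : ℝ, 0 < ε → ε < κ / C →
      ∃ δ₀ : ℝ, 0 < δ₀ ∧ ∀ δ : ℝ, 0 < δ → δ < δ₀ →
        ∀ (α : ℝ) (A : Set (EuclideanSpace ℝ (Fin n))), Bornology.IsBounded A →
        ∀ (μ : Measure (Gr n m)) [IsFiniteMeasure μ],
          δ ^ (-α - C * ε) ≤ (Ncov δ A : ℝ) →
          (m < n → ∀ ρ : ℝ, δ ≤ ρ → ∀ W : Gr n (n - m),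
            μ.real (Vang W ρ) ≤ δ ^ (-ε) * ρ ^ κ) →
          μ.real (exceptionalSet n m δ α ε A) ≤ δ ^ ε := by
  have hn : 0 < n := hm.trans_le hmn
  have ha : 0 < (n + 3) / κ := by positivity
  set a : ℝ := (n + 3) / κ
  set b : ℝ := 14 * n * (2 * n + 2) ^ n
  refine ⟨2 * n + 3 + 2 * n ^ 2 * a, by linarith [show 0 ≤ 2 * n + 2 * n ^ 2 * a by positivity],
    fun ε hε hεC => ⟨min 1 (Real.exp (-(5 * n ^ 2 * Real.log b / ε))), by positivity,
      fun δ hδ hδ₀ α A hA μ _ hAN hμ => ?_⟩⟩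
  obtain ⟨hδ1, hδb⟩ := lt_min_iff.1 hδ₀
  rcases hmn.eq_or_lt with rfl | hlt
  · rw [exceptionalSet_self_eq_empty hn hδ hδ1.le hε.le ?_ hAN, measureReal_empty]
    · positivity
    · linarith [show 0 ≤ 2 * m + 2 * m ^ 2 * a by positivity]
  have haε : a * ε ≤ 1 := by
    rw [lt_div_iff₀ (by positivity)] at hεC
    rw [div_mul_eq_mul_div, div_le_one hκ]
    nlinarith [show 0 ≤ ε * (n + 2 * n ^ 2 * a) by positivity]
  refine measureReal_exceptionalSet_le hm hmn hδ hδ1.le hε.le ha.le haε (div_mul_cancel₀ _ hκ.ne')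
    (by linarith) le_rfl ?_ hA hAN (hμ hlt)
  rw [← Real.log_lt_iff_lt_exp hδ, lt_neg, div_lt_iff₀ hε] at hδb
  linarith

theorem proposition16 (n m : ℕ) (hm : 0 < m) (hmn : m ≤ n) (α κ : ℝ) (hα : 0 < α)
    (hαn : α < n) (hκ : 0 < κ) :
    ∃ C : ℝ, 1 < C ∧ ∀ ε : ℝ, 0 < ε → ε < κ / C →
      ∃ δ₀ : ℝ, 0 < δ₀ ∧ ∀ δ : ℝ, 0 < δ → δ < δ₀ →
        ∀ A : Set (EuclideanSpace ℝ (Fin n)), A ⊆ Metric.closedBall 0 1 →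
        ∀ (μ : Measure (Gr n m)) [IsProbabilityMeasure μ],
          δ ^ (-α - C * ε) ≤ (Ncov δ A : ℝ) →
          (m < n → ∀ ρ : ℝ, δ ≤ ρ → ∀ W : Gr n (n - m),
            μ.real (Vang W ρ) ≤ δ ^ (-ε) * ρ ^ κ) →
          μ.real (exceptionalSet n m δ α ε A) ≤ δ ^ ε := by
  obtain ⟨C, hC, h⟩ := proposition16_general hm hmn hκ
  refine ⟨C, hC, fun ε hε hεC => (h ε hε hεC).imp fun δ₀ hδ₀ => ⟨hδ₀.1, fun δ hδ hlt A hA => ?_⟩⟩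
  exact fun μ _ => hδ₀.2 δ hδ hlt α A (Metric.isBounded_closedBall.subset hA) μ
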